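/- Let $n\ge 3$, $2^*=2n/(n-2)$, and let $d\mu(r)=r^{n-1}\,dr$ on $\mathbb{R}^+=(0,\infty)$. For a function $h:\mathbb{R}^n\to\mathbb{C}$ let $$\mathcal{M}(h)(r)=\frac1{|\mathbb{S}^{n-1}|}\int_{\mathbb{S}^{n-1}}h(r\omega)\,d\omega ,\qquad r>0,$$ be its integral mean over the sphere of radius $r$ ($d\omega$ is the surface measure on the unit sphere $\mathbb{S}^{n-1}$). Then there exists a constant $C>0$ depending only on $n$ such that for every $h\in L^2(\mathbb{R}^n)$ whose weak gradient $\nabla h$ also lies in $L^2(\mathbb{R}^n)$ the following holds: $h/|\cdot|\in L^2(\mathbb{R}^n)$, the quantity $\|\nabla h\|^2_{L^2(\mathbb{R}^n)}-\left(\frac{n-2}{2}\right)^2\|h/|\cdot|\|^2_{L^2(\mathbb{R}^n)}$ is non-negative, $\mathcal{M}(h)(r)$ is a convergent integral for almost every $r>0$, $\mathcal{M}(h)\in L^{2^*}(\mathbb{R}^+;d\mu)$, and $$\|\mathcal{M}(h)\|^2_{L^{2^*}(\mathbb{R}^+;d\mu)}\le C\left\{\|\nabla h\|^2_{L^2(\mathbb{R}^n)}-\left(\tfrac{n-2}{2}\right)^2\left\|h/|\cdot|\right\|^2_{L^2(\mathbb{R}^n)}\right\}^{1/n}\left\{\left\|h/|\cdot|\right\|^2_{L^2(\mathbb{R}^n)}\right\}^{1-1/n}.$$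 Moreover, for every such $h$ and every $\varepsilon>0$, $$\varepsilon^{1-1/n}\,\|\mathcal{M}(h)\|^2_{L^{2^*}(\mathbb{R}^+;d\mu)}\le C\left\{\|\nabla h\|^2_{L^2(\mathbb{R}^n)}-\left[\left(\tfrac{n-2}{2}\right)^2-\varepsilon\right]\left\|h/|\cdot|\right\|^2_{L^2(\mathbb{R}^n)}\right\}.$$ -/

import Mathlib

open MeasureTheory
open scoped ENNReal ContDiff

/-- `g` is the weak (distributional) gradient of the complex-valued function `h` on `ℝⁿ`: both are
locally integrable, and `∫ h ∂ⱼφ = -∫ gⱼ φ` for every coordinate `j` and every real-valued test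
function `φ ∈ C_c^∞(ℝⁿ)`. -/
structure IsWeakGradient {n : ℕ} (h : EuclideanSpace ℝ (Fin n) → ℂ)
    (g : EuclideanSpace ℝ (Fin n) → EuclideanSpace ℂ (Fin n)) : Prop where
  locallyIntegrable : LocallyIntegrable h volume
  locallyIntegrable_grad : LocallyIntegrable g volume
  integral_eq : ∀ φ : EuclideanSpace ℝ (Fin n) → ℝ, ContDiff ℝ ∞ φ → HasCompactSupport φ →
    ∀ j : Fin n,
      ∫ x, (fderiv ℝ φ x (EuclideanSpace.single j 1)) • h x = - ∫ x, φ x • g x j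

/-- The integral mean of `h` over the sphere of radius `r`:
`M(h)(r) = |S^{n-1}|⁻¹ ∫_{S^{n-1}} h (r u) du`, where `du` is the surface measure of the unit
sphere. -/
noncomputable def sphericalMean {n : ℕ} (h : EuclideanSpace ℝ (Fin n) → ℂ) (r : ℝ) : ℂ :=
  ((volume : Measure (EuclideanSpace ℝ (Fin n))).toSphere.real Set.univ)⁻¹ •
    ∫ u : Metric.sphere (0 : EuclideanSpace ℝ (Fin n)) 1,
      h (r • (u : EuclideanSpace ℝ (Fin n)))
        ∂(volume : Measure (EuclideanSpace ℝ (Fin n))).toSphere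

/-- The measure `dμ(r) = r^{n-1} dr` on `(0, ∞)`. -/
noncomputable def radialMeasure (n : ℕ) : Measure (Set.Ioi (0 : ℝ)) :=
  Measure.volumeIoiPow (n - 1)

/-- The critical Sobolev exponent `2* = 2n / (n - 2)` (used for `n ≥ 3`). -/
noncomputable def sobolevExponent (n : ℕ) : ℝ≥0∞ :=
  ENNReal.ofReal (2 * (n : ℝ) / ((n : ℝ) - 2))

/-- The squared norm `‖M(h)‖²` in `L^{2*}(ℝ⁺; r^{n-1} dr)`. -/
noncomputable def sphericalMeanNormSq {n : ℕ} (h : EuclideanSpace ℝ (Fin n) → ℂ) : ℝ :=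
  (eLpNorm (fun r : Set.Ioi (0 : ℝ) => sphericalMean h (r : ℝ))
    (sobolevExponent n) (radialMeasure n)).toReal ^ 2

/-- The function `h / |·|`. Its value at the origin is irrelevant. -/
noncomputable def divNorm {n : ℕ} (h : EuclideanSpace ℝ (Fin n) → ℂ) :
    EuclideanSpace ℝ (Fin n) → ℂ :=
  fun x => h x / (‖x‖ : ℂ)

/-- The squared norm `‖f‖²` in `L²(ℝⁿ)`. -/
noncomputable def l2NormSq {n : ℕ} {F : Type*} [NormedAddCommGroup F]
    (f : EuclideanSpace ℝ (Fin n) → F) : ℝ :=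
  (eLpNorm f 2 volume).toReal ^ 2

/-! Write `n = m + 3`, so that `(n - 2) / 2 = (m + 1) / 2`, and let `E h = x · ∇h + (n - 2) / 2 *
h`. On a ray, with `u r = h (r ω)` and `v = r u' + (n - 2) / 2 * u`, the proof rests on one
identity: the derivative of `r ^ (n - 2) * |u| ^ 2` is `2 r ^ (n - 3) * Re (v * conj u)`. It is used
twice, for `h` of class `C¹` with compact support.

Integrated over `(0, ∞)`, it removes the cross term in `|v| ^ 2`. Integration over directions then
gives Hardy's inequality with remainder: `‖E h / |·|‖²` is at most the deficit `Q = ‖∇h‖² - ((n - 2)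
/ 2)² ‖h / |·|‖²` (`hardy_with_remainder`).

Integrated from `r` to infinity, and combined with Cauchy-Schwarz, it bounds `N r = ∫ |h (r ω)|²
dω`: `r ^ (n - 2) * N r ≤ K = 2 ‖E h / |·|‖ ‖h / |·|‖` (`lintegral_sphere_normSq_le`).

Since `|M h|² ≤ N / |S|`, the power `2* = 2 q`, `q = n / (n - 2)`, leads to `N ^ q = N ^ (2 / (n -
2)) * N ≤ K ^ (2 / (n - 2)) * r ^ (-2) * N`, and `r ^ (-2) * N` integrates to `‖h / |·|‖²`. The
`q`-th root is the first inequality, with constant `2 ^ (2 / n) / |S|`. Mollification, cutoff and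
Fatou's lemma extend it to all of `H¹`; weighted AM-GM turns it into the inequality with `ε`. -/

/-! ### Polar coordinates. -/

section Polar

variable {n : ℕ}

/-- Polar coordinates preserve the measure. -/
theorem measurePreserving_polar (hn : 1 ≤ n) :
    MeasurePreserving
      (fun p : Metric.sphere (0 : EuclideanSpace ℝ (Fin n)) 1 × Set.Ioi (0 : ℝ) =>
        (p.2 : ℝ) • (p.1 : EuclideanSpace ℝ (Fin n)))
      ((volume : Measure (EuclideanSpace ℝ (Fin n))).toSphere.prod (radialMeasure n)) volume := by
  have : Nonempty (Fin n) := ⟨⟨0, hn⟩⟩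
  have h1 := (volume : Measure (EuclideanSpace ℝ (Fin n))).measurePreserving_homeomorphUnitSphereProd
  rw [finrank_euclideanSpace_fin] at h1
  have h2 := h1.symm (homeomorphUnitSphereProd (EuclideanSpace ℝ (Fin n))).toMeasurableEquiv
  have h3 : MeasurePreserving (Subtype.val : ({0}ᶜ : Set (EuclideanSpace ℝ (Fin n))) → _)
      ((volume : Measure (EuclideanSpace ℝ (Fin n))).comap Subtype.val) volume := by
    refine ⟨measurable_subtype_coe, ?_⟩
    rw [map_comap_subtype_coe (measurableSet_singleton _).compl, restrict_compl_singleton]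
  exact h3.comp h2

theorem lintegral_radialMeasure (f : ℝ → ℝ≥0∞) :
    ∫⁻ r : Set.Ioi (0 : ℝ), f r ∂(radialMeasure n) =
      ∫⁻ r in Set.Ioi (0 : ℝ), ENNReal.ofReal (r ^ (n - 1)) * f r := by
  rw [radialMeasure, Measure.volumeIoiPow, lintegral_withDensity_eq_lintegral_mul_non_measurable]
  · simp only [Pi.mul_apply]
    rw [lintegral_subtype_comap measurableSet_Ioi
      (fun r : ℝ => ENNReal.ofReal (r ^ (n - 1)) * f r)]
  · fun_prop
  · simp

theorem lintegral_polar (hn : 1 ≤ n) {f : EuclideanSpace ℝ (Fin n) → ℝ≥0∞} (hf : AEMeasurable f) :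
    ∫⁻ x, f x = ∫⁻ u, ∫⁻ r, f ((r : ℝ) • (u : EuclideanSpace ℝ (Fin n))) ∂(radialMeasure n)
      ∂(volume : Measure (EuclideanSpace ℝ (Fin n))).toSphere := by
  have hp := measurePreserving_polar hn
  have : SFinite (radialMeasure n) := by unfold radialMeasure; infer_instance
  rw [← lintegral_prod (fun p : Metric.sphere (0 : EuclideanSpace ℝ (Fin n)) 1 × Set.Ioi (0 : ℝ) =>
     f ((p.2 : ℝ) • (p.1 : EuclideanSpace ℝ (Fin n)))) (hf.comp_quasiMeasurePreserving hp.quasiMeasurePreserving)]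
  conv_lhs => rw [← hp.map_eq, lintegral_map' (by rwa [hp.map_eq]) hp.aemeasurable]

/-- With the radius outermost, this order suits estimates on spheres; `lintegral_polar` suits
estimates along rays. -/
theorem lintegral_polar_symm (hn : 1 ≤ n) {f : EuclideanSpace ℝ (Fin n) → ℝ≥0∞}
    (hf : AEMeasurable f) :
    ∫⁻ x, f x = ∫⁻ r, ∫⁻ u, f ((r : ℝ) • (u : EuclideanSpace ℝ (Fin n)))
      ∂(volume : Measure (EuclideanSpace ℝ (Fin n))).toSphere ∂(radialMeasure n) := by
  have hp := measurePreserving_polar hn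
  have : SFinite (radialMeasure n) := by unfold radialMeasure; infer_instance
  rw [← lintegral_prod_symm (fun p : Metric.sphere (0 : EuclideanSpace ℝ (Fin n)) 1 × Set.Ioi (0 : ℝ) =>
     f ((p.2 : ℝ) • (p.1 : EuclideanSpace ℝ (Fin n)))) (hf.comp_quasiMeasurePreserving hp.quasiMeasurePreserving)]
  conv_lhs => rw [← hp.map_eq, lintegral_map' (by rwa [hp.map_eq]) hp.aemeasurable]

end Polar

/-! ### One-dimensional Hardy identity and pointwise bound. -/

section HalfLine

variable {u u' : ℝ → ℂ} (m : ℕ)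

theorem hasDerivAt_pow_mul_normSq {r : ℝ} (hu : HasDerivAt u (u' r) r) :
    HasDerivAt (fun t => t ^ (m + 1) * ‖u t‖ ^ 2)
      ((m + 1) * r ^ m * ‖u r‖ ^ 2 + r ^ (m + 1) * (2 * inner ℝ (u r) (u' r))) r := by
  have h1 := (hasDerivAt_pow (m + 1) r).mul hu.norm_sq
  exact h1.congr_deriv (by push_cast; simp)

/-- The pointwise identity behind Hardy's inequality on a half-line. -/
theorem pow_mul_normSq_identity (r : ℝ) (a b : ℂ) :
    r ^ m * ‖(r : ℂ) * b + ((m + 1) / 2 : ℂ) * a‖ ^ 2 + ((m + 1) / 2 : ℝ) ^ 2 * (r ^ m * ‖a‖ ^ 2) =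
      r ^ (m + 2) * ‖b‖ ^ 2 + ((m + 1) / 2 : ℝ) *
        ((m + 1) * r ^ m * ‖a‖ ^ 2 + r ^ (m + 1) * (2 * inner ℝ a b)) := by
  have e : ((m + 1) / 2 : ℂ) = (((m + 1) / 2 : ℝ) : ℂ) := by push_cast; rfl
  rw [e]
  generalize hc : ((m + 1) / 2 : ℝ) = c
  have : (m : ℝ) + 1 = 2 * c := by rw [← hc]; ring
  rw [this]
  simp only [Complex.sq_norm, Complex.normSq_apply, Complex.inner, Complex.mul_re, Complex.mul_im,
    Complex.add_re, Complex.add_im, Complex.ofReal_re, Complex.ofReal_im, Complex.conj_re,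
    Complex.conj_im]
  ring

/-- Hardy's identity on the half-line. -/
theorem lintegral_hardy_identity (hu : ∀ r, HasDerivAt u (u' r) r) (hu' : Continuous u')
    (hs : HasCompactSupport u) :
    (∫⁻ r in Set.Ioi (0 : ℝ),
        ENNReal.ofReal (r ^ m * ‖(r : ℂ) * u' r + ((m + 1) / 2 : ℂ) * u r‖ ^ 2)) +
      ENNReal.ofReal (((m + 1) / 2 : ℝ) ^ 2) *
        ∫⁻ r in Set.Ioi (0 : ℝ), ENNReal.ofReal (r ^ m * ‖u r‖ ^ 2) =
      ∫⁻ r in Set.Ioi (0 : ℝ), ENNReal.ofReal (r ^ (m + 2) * ‖u' r‖ ^ 2) := by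
  have hc : Continuous u := continuous_iff_continuousAt.2 fun r => (hu r).continuousAt
  have hs' : HasCompactSupport u' := by
    rw [show u' = deriv u from funext fun r => (hu r).deriv.symm]; exact hs.deriv
  have i1 : Integrable (fun r : ℝ => r ^ m * ‖(r : ℂ) * u' r + ((m + 1) / 2 : ℂ) * u r‖ ^ 2) := by
    refine Continuous.integrable_of_hasCompactSupport (by fun_prop) ?_
    exact (((hs'.mul_left (f := fun r : ℝ => (r : ℂ))).add
      (hs.mul_left (f := fun _ => ((m + 1) / 2 : ℂ)))).norm.comp_left
        (g := fun x => x ^ 2) (by simp)).mul_left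
  have i2 : Integrable (fun r : ℝ => r ^ m * ‖u r‖ ^ 2) := by
    refine Continuous.integrable_of_hasCompactSupport (by fun_prop) ?_
    exact (hs.norm.comp_left (g := fun x => x ^ 2) (by simp)).mul_left
  have i3 : Integrable (fun r : ℝ => r ^ (m + 2) * ‖u' r‖ ^ 2) := by
    refine Continuous.integrable_of_hasCompactSupport (by fun_prop) ?_
    exact (hs'.norm.comp_left (g := fun x => x ^ 2) (by simp)).mul_left
  have hs4 : HasCompactSupport (fun t => t ^ (m + 1) * ‖u t‖ ^ 2) :=
    (hs.norm.comp_left (g := fun x => x ^ 2) (by simp)).mul_left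
  have hd := fun r => hasDerivAt_pow_mul_normSq (u' := u') m (hu r)
  have c4 : Continuous fun r => (m + 1) * r ^ m * ‖u r‖ ^ 2 + r ^ (m + 1) * (2 * inner ℝ (u r) (u' r)) := by
    fun_prop
  have e4 : deriv (fun t => t ^ (m + 1) * ‖u t‖ ^ 2) = _ := funext fun r => (hd r).deriv
  -- The cross term is an exact derivative; the boundary value at `0` vanishes because of the factor
  -- `t ^ (m + 1)`.
  have h4 := HasCompactSupport.integral_Ioi_deriv_eq (contDiff_one_iff_deriv.2
    ⟨fun r => (hd r).differentiableAt, by rw [e4]; exact c4⟩) hs4 0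
  rw [e4] at h4
  have i4 : Integrable fun r => (m + 1) * r ^ m * ‖u r‖ ^ 2 + r ^ (m + 1) * (2 * inner ℝ (u r) (u' r)) := by
    refine Continuous.integrable_of_hasCompactSupport c4 ?_
    rw [← e4]; exact hs4.deriv
  have key : (∫ r in Set.Ioi (0 : ℝ), r ^ m * ‖(r : ℂ) * u' r + ((m + 1) / 2 : ℂ) * u r‖ ^ 2) +
      ((m + 1) / 2 : ℝ) ^ 2 * ∫ r in Set.Ioi (0 : ℝ), r ^ m * ‖u r‖ ^ 2 =
      ∫ r in Set.Ioi (0 : ℝ), r ^ (m + 2) * ‖u' r‖ ^ 2 := by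
    rw [← integral_const_mul, ← integral_add i1.integrableOn (i2.integrableOn.const_mul _)]
    simp_rw [pow_mul_normSq_identity]
    rw [integral_add i3.integrableOn (i4.integrableOn.const_mul _), integral_const_mul, h4]
    simp
  have pos : ∀ {k : ℕ} {f : ℝ → ℝ}, (∀ r, 0 ≤ f r) →
      0 ≤ᵐ[volume.restrict (Set.Ioi (0 : ℝ))] fun r => r ^ k * f r := by
    intro k f hf
    filter_upwards [ae_restrict_mem measurableSet_Ioi] with r hr
    exact mul_nonneg (pow_nonneg (le_of_lt hr) _) (hf r)
  rw [← ofReal_integral_eq_lintegral_ofReal i1.integrableOn (pos fun r => by positivity),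
    ← ofReal_integral_eq_lintegral_ofReal i2.integrableOn (pos fun r => by positivity),
    ← ofReal_integral_eq_lintegral_ofReal i3.integrableOn (pos fun r => by positivity),
    ← ENNReal.ofReal_mul (by positivity), ← ENNReal.ofReal_add
    (integral_nonneg_of_ae (pos fun r => by positivity))
    (mul_nonneg (by positivity) (integral_nonneg_of_ae (pos fun r => by positivity))), key]

/-- The derivative of `t ^ (m + 1) * ‖u t‖ ^ 2` is integrated from `r` to infinity, where the
function vanishes. Enlarging the domain to `(0, ∞)` makes the bound independent of `r`. -/
theorem pow_mul_normSq_le_integral (hu : ∀ r, HasDerivAt u (u' r) r) (hu' : Continuous u')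
    (hs : HasCompactSupport u) {r : ℝ} (hr : 0 < r) :
    ENNReal.ofReal (r ^ (m + 1) * ‖u r‖ ^ 2) ≤ 2 *
      ∫⁻ t in Set.Ioi (0 : ℝ),
        ENNReal.ofReal (t ^ m * (‖(t : ℂ) * u' t + ((m + 1) / 2 : ℂ) * u t‖ * ‖u t‖)) := by
  have hc : Continuous u := continuous_iff_continuousAt.2 fun r => (hu r).continuousAt
  have i1 : Integrable (fun t : ℝ => t ^ m *
      (‖(t : ℂ) * u' t + ((m + 1) / 2 : ℂ) * u t‖ * ‖u t‖)) :=
    Continuous.integrable_of_hasCompactSupport (by fun_prop) hs.norm.mul_left.mul_left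
  have hs4 : HasCompactSupport (fun t => t ^ (m + 1) * ‖u t‖ ^ 2) :=
    (hs.norm.comp_left (g := fun x => x ^ 2) (by simp)).mul_left
  have hd := fun r => hasDerivAt_pow_mul_normSq (u' := u') m (hu r)
  have c4 : Continuous fun r => (m + 1) * r ^ m * ‖u r‖ ^ 2 +
      r ^ (m + 1) * (2 * inner ℝ (u r) (u' r)) := by
    fun_prop
  have e4 : deriv (fun t => t ^ (m + 1) * ‖u t‖ ^ 2) = _ := funext fun r => (hd r).deriv
  have h4 := HasCompactSupport.integral_Ioi_deriv_eq (contDiff_one_iff_deriv.2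
    ⟨fun r => (hd r).differentiableAt, by rw [e4]; exact c4⟩) hs4 r
  rw [e4] at h4
  have hle : ∀ t ∈ Set.Ioi r, ‖(m + 1) * t ^ m * ‖u t‖ ^ 2 +
      t ^ (m + 1) * (2 * inner ℝ (u t) (u' t))‖ ≤
      2 * (t ^ m * (‖(t : ℂ) * u' t + ((m + 1) / 2 : ℂ) * u t‖ * ‖u t‖)) := by
    intro t ht
    have ht0 : 0 < t := hr.trans ht
    have e : (m + 1) * t ^ m * ‖u t‖ ^ 2 + t ^ (m + 1) * (2 * inner ℝ (u t) (u' t)) =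
        2 * (t ^ m * inner ℝ ((t : ℂ) * u' t + ((m + 1) / 2 : ℂ) * u t) (u t)) := by
      have e : ((m + 1) / 2 : ℂ) = (((m + 1) / 2 : ℝ) : ℂ) := by push_cast; rfl
      rw [e]
      simp only [Complex.sq_norm, Complex.normSq_apply, Complex.inner, Complex.mul_re,
        Complex.mul_im, Complex.add_re, Complex.add_im, Complex.ofReal_re, Complex.ofReal_im,
        Complex.conj_re, Complex.conj_im]
      ring
    rw [e, norm_mul, norm_mul, Real.norm_of_nonneg (by positivity : 0 ≤ t ^ m),
      Real.norm_of_nonneg zero_le_two]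
    gcongr
    exact norm_inner_le_norm _ _
  have h5 : r ^ (m + 1) * ‖u r‖ ^ 2 ≤ 2 * ∫ t in Set.Ioi r, t ^ m *
      (‖(t : ℂ) * u' t + ((m + 1) / 2 : ℂ) * u t‖ * ‖u t‖) := by
    rw [← neg_eq_iff_eq_neg.2 h4, ← integral_const_mul]
    refine (le_abs_self _).trans ?_
    rw [abs_neg]
    exact norm_integral_le_of_norm_le (i1.integrableOn.const_mul 2)
      ((ae_restrict_iff' measurableSet_Ioi).2 (Filter.Eventually.of_forall hle))
  refine (ENNReal.ofReal_le_ofReal h5).trans ?_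
  rw [ENNReal.ofReal_mul zero_le_two, ENNReal.ofReal_ofNat]
  gcongr
  rw [ofReal_integral_eq_lintegral_ofReal i1.integrableOn]
  · exact lintegral_mono_set (Set.Ioi_subset_Ioi hr.le)
  · filter_upwards [ae_restrict_mem measurableSet_Ioi] with t ht
    have : 0 < t := hr.trans ht
    positivity

end HalfLine

/-! ### Hardy's inequality with remainder and the bound on spheres, for `C¹` functions. -/

section ClassicalGradient

/-- The gradient of a complex-valued function, as a vector of partial derivatives. -/
noncomputable def complexGradient {n : ℕ} (h : EuclideanSpace ℝ (Fin n) → ℂ)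
    (x : EuclideanSpace ℝ (Fin n)) : EuclideanSpace ℂ (Fin n) :=
  WithLp.toLp 2 fun j => fderiv ℝ h x (EuclideanSpace.single j 1)

theorem norm_fderiv_apply_le {n : ℕ} (h : EuclideanSpace ℝ (Fin n) → ℂ)
    (x v : EuclideanSpace ℝ (Fin n)) :
    ‖fderiv ℝ h x v‖ ≤ ‖complexGradient h x‖ * ‖v‖ := by
  have hv : v = ∑ j, v j • EuclideanSpace.single j (1 : ℝ) := by
    ext i
    simp [Finset.sum_apply, Pi.single_apply]
  conv_lhs => rw [hv, map_sum]
  simp_rw [map_smul]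
  refine (norm_sum_le _ _).trans ?_
  rw [EuclideanSpace.norm_eq, EuclideanSpace.norm_eq]
  simp_rw [norm_smul, mul_comm ‖v _‖]
  exact Real.sum_mul_le_sqrt_mul_sqrt _ _ _

theorem continuous_complexGradient {n : ℕ} {h : EuclideanSpace ℝ (Fin n) → ℂ} (hh : ContDiff ℝ 1 h) :
    Continuous (complexGradient h) := by
  have := hh.continuous_fderiv one_ne_zero
  unfold complexGradient
  fun_prop

theorem hasCompactSupport_complexGradient {n : ℕ} {h : EuclideanSpace ℝ (Fin n) → ℂ}
    (hs : HasCompactSupport h) : HasCompactSupport (complexGradient h) := by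
  refine (hs.fderiv ℝ).mono fun x hx => ?_
  contrapose! hx
  simp only [Function.mem_support, not_not] at hx ⊢
  ext j
  simp [complexGradient, hx]

variable {m : ℕ}

/-- The Euler operator `x · ∇ + (n - 2) / 2` in dimension `n = m + 3`. -/
noncomputable def eulerOperator (h : EuclideanSpace ℝ (Fin (m + 3)) → ℂ)
    (x : EuclideanSpace ℝ (Fin (m + 3))) : ℂ :=
  fderiv ℝ h x x + ((m + 1) / 2 : ℂ) * h x

variable {h : EuclideanSpace ℝ (Fin (m + 3)) → ℂ}

theorem continuous_eulerOperator (hh : ContDiff ℝ 1 h) : Continuous (eulerOperator h) := by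
  have := hh.continuous_fderiv one_ne_zero
  have := hh.continuous
  unfold eulerOperator
  fun_prop

theorem hasDerivAt_ray (hh : ContDiff ℝ 1 h) (u : EuclideanSpace ℝ (Fin (m + 3))) (r : ℝ) :
    HasDerivAt (fun t : ℝ => h (t • u)) (fderiv ℝ h (r • u) u) r := by
  have h1 : HasDerivAt (fun t : ℝ => t • u) u r := by
    simpa using (hasDerivAt_id r).smul_const u
  exact ((hh.differentiable one_ne_zero (r • u)).hasFDerivAt).comp_hasDerivAt r h1

theorem hasCompactSupport_ray (hs : HasCompactSupport h) {u : EuclideanSpace ℝ (Fin (m + 3))}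
    (hu : u ≠ 0) : HasCompactSupport (fun t : ℝ => h (t • u)) :=
  hs.comp_isClosedEmbedding (isClosedEmbedding_smul_left hu)

theorem eulerOperator_ray (h : EuclideanSpace ℝ (Fin (m + 3)) → ℂ)
    (u : EuclideanSpace ℝ (Fin (m + 3))) (r : ℝ) :
    eulerOperator h (r • u) =
      (r : ℂ) * fderiv ℝ h (r • u) u + ((m + 1) / 2 : ℂ) * h (r • u) := by
  simp [eulerOperator]

/-- The Jacobian `r ^ (m + 2)` absorbs the weight `r ^ (-2)`, leaving the `r ^ m` of the half-line
estimates. -/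
theorem lintegral_div_normSq_polar {f : EuclideanSpace ℝ (Fin (m + 3)) → ℝ} (hf : Continuous f) :
    ∫⁻ x, ENNReal.ofReal (f x / ‖x‖ ^ 2) =
      ∫⁻ u, (∫⁻ r in Set.Ioi (0 : ℝ),
          ENNReal.ofReal (r ^ m * f (r • (u : EuclideanSpace ℝ (Fin (m + 3))))))
        ∂(volume : Measure (EuclideanSpace ℝ (Fin (m + 3)))).toSphere := by
  rw [lintegral_polar (by lia) (by fun_prop)]
  refine lintegral_congr fun u => ?_
  rw [lintegral_radialMeasure (fun r => ENNReal.ofReal (f (r • (u : EuclideanSpace ℝ (Fin (m + 3)))) /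
    ‖r • (u : EuclideanSpace ℝ (Fin (m + 3)))‖ ^ 2))]
  refine setLIntegral_congr_fun measurableSet_Ioi fun r (hr : 0 < r) => ?_
  have hu : ‖(u : EuclideanSpace ℝ (Fin (m + 3)))‖ = 1 := by simp
  simp only [norm_smul, hu, Real.norm_of_nonneg hr.le]
  rw [← ENNReal.ofReal_mul (by positivity)]
  congr 1
  simp only [show m + 3 - 1 = m + 2 from rfl]
  field_simp
  ring

theorem measurable_lintegral_ray {f : EuclideanSpace ℝ (Fin (m + 3)) → ℝ} (hf : Continuous f) (k : ℕ) :
    Measurable fun u : Metric.sphere (0 : EuclideanSpace ℝ (Fin (m + 3))) 1 =>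
      ∫⁻ r in Set.Ioi (0 : ℝ),
          ENNReal.ofReal (r ^ k * f (r • (u : EuclideanSpace ℝ (Fin (m + 3))))) := by
  refine Measurable.lintegral_prod_right' (f := fun (p : Metric.sphere (0 : EuclideanSpace ℝ (Fin (m + 3))) 1 × ℝ) =>
     ENNReal.ofReal (p.2 ^ k * f (p.2 • (p.1 : EuclideanSpace ℝ (Fin (m + 3)))))) ?_
  fun_prop

/-- Hardy's inequality with remainder, for `C¹` functions with compact support. -/
theorem hardy_with_remainder (hh : ContDiff ℝ 1 h) (hs : HasCompactSupport h) :
    (∫⁻ x, ENNReal.ofReal (‖eulerOperator h x‖ ^ 2 / ‖x‖ ^ 2)) +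
      ENNReal.ofReal (((m + 1) / 2 : ℝ) ^ 2) * ∫⁻ x, ENNReal.ofReal (‖h x‖ ^ 2 / ‖x‖ ^ 2) ≤
      ∫⁻ x, ENNReal.ofReal (‖complexGradient h x‖ ^ 2) := by
  have c1 := continuous_eulerOperator hh
  have c2 := hh.continuous
  have c3 := hh.continuous_fderiv one_ne_zero
  calc _ = ∫⁻ x, ENNReal.ofReal (‖fderiv ℝ h x x‖ ^ 2 / ‖x‖ ^ 2) := by
        rw [lintegral_div_normSq_polar (by fun_prop), lintegral_div_normSq_polar (by fun_prop),
          lintegral_div_normSq_polar (by fun_prop), ← lintegral_const_mul _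
          (measurable_lintegral_ray (f := fun x => ‖h x‖ ^ 2) (by fun_prop) m), ← lintegral_add_left
          (measurable_lintegral_ray (f := fun x => ‖eulerOperator h x‖ ^ 2) (by fun_prop) m)]
        refine lintegral_congr fun u => ?_
        simp_rw [eulerOperator_ray]
        rw [lintegral_hardy_identity m (hasDerivAt_ray hh u) (by fun_prop)
          (hasCompactSupport_ray hs (by simp [← norm_ne_zero_iff]))]
        refine lintegral_congr fun r => ?_
        rw [map_smul, norm_smul, mul_pow, Real.norm_eq_abs, sq_abs]
        congr 1
        ring
    _ ≤ _ := by
        -- The only loss: the full gradient replaces the radial derivative. At `x = 0` the quotient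
        -- is `0` by convention.
        refine lintegral_mono fun x => ENNReal.ofReal_le_ofReal ?_
        refine div_le_of_le_mul₀ (by positivity) (by positivity) ?_
        rw [← mul_pow]
        gcongr
        exact norm_fderiv_apply_le h x x

/-- The bound on each ray is integrated over directions, and Cauchy-Schwarz on the whole space
splits the product. -/
theorem lintegral_sphere_normSq_le (hh : ContDiff ℝ 1 h) (hs : HasCompactSupport h) {r : ℝ}
    (hr : 0 < r) :
    ENNReal.ofReal (r ^ (m + 1)) * ∫⁻ u : Metric.sphere (0 : EuclideanSpace ℝ (Fin (m + 3))) 1,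
        ‖h (r • (u : EuclideanSpace ℝ (Fin (m + 3))))‖ₑ ^ 2
        ∂(volume : Measure (EuclideanSpace ℝ (Fin (m + 3)))).toSphere ≤
      2 * ((∫⁻ x, ENNReal.ofReal (‖eulerOperator h x‖ ^ 2 / ‖x‖ ^ 2)) ^ (1 / 2 : ℝ) *
        (∫⁻ x, ENNReal.ofReal (‖h x‖ ^ 2 / ‖x‖ ^ 2)) ^ (1 / 2 : ℝ)) := by
  have c1 := continuous_eulerOperator hh
  have c2 := hh.continuous
  have c3 := hh.continuous_fderiv one_ne_zero
  have e2 : ∀ (f : EuclideanSpace ℝ (Fin (m + 3)) → ℂ) x,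
      ENNReal.ofReal (‖f x‖ / ‖x‖) ^ (2 : ℝ) = ENNReal.ofReal (‖f x‖ ^ 2 / ‖x‖ ^ 2) := by
    intro f x
    rw [ENNReal.ofReal_rpow_of_nonneg (by positivity) (by positivity), Real.rpow_two, div_pow]
  calc _ = ∫⁻ u : Metric.sphere (0 : EuclideanSpace ℝ (Fin (m + 3))) 1,
        ENNReal.ofReal (r ^ (m + 1) * ‖h (r • (u : EuclideanSpace ℝ (Fin (m + 3))))‖ ^ 2)
        ∂(volume : Measure (EuclideanSpace ℝ (Fin (m + 3)))).toSphere := by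
        rw [← lintegral_const_mul _ (Continuous.measurable (by fun_prop))]
        refine lintegral_congr fun u => ?_
        rw [ENNReal.ofReal_mul (by positivity), ENNReal.ofReal_pow (norm_nonneg _),
          ofReal_norm]
    _ ≤ ∫⁻ u : Metric.sphere (0 : EuclideanSpace ℝ (Fin (m + 3))) 1,
        2 * (∫⁻ t in Set.Ioi (0 : ℝ), ENNReal.ofReal (t ^ m *
          (‖eulerOperator h (t • (u : EuclideanSpace ℝ (Fin (m + 3))))‖ *
            ‖h (t • (u : EuclideanSpace ℝ (Fin (m + 3))))‖)))
        ∂(volume : Measure (EuclideanSpace ℝ (Fin (m + 3)))).toSphere := by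
        refine lintegral_mono fun u => ?_
        simp_rw [eulerOperator_ray]
        exact pow_mul_normSq_le_integral m (hasDerivAt_ray hh u) (by fun_prop)
          (hasCompactSupport_ray hs (by simp [← norm_ne_zero_iff])) hr
    _ = 2 * ∫⁻ x, ENNReal.ofReal (‖eulerOperator h x‖ / ‖x‖) * ENNReal.ofReal (‖h x‖ / ‖x‖) := by
        rw [lintegral_const_mul _ (measurable_lintegral_ray
          (f := fun x => ‖eulerOperator h x‖ * ‖h x‖) (by fun_prop) m),
          ← lintegral_div_normSq_polar (f := fun x => ‖eulerOperator h x‖ * ‖h x‖) (by fun_prop)]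
        congr 1
        refine lintegral_congr fun x => ?_
        rw [← ENNReal.ofReal_mul (by positivity)]
        congr 1
        ring
    _ ≤ _ := by
        gcongr
        refine (ENNReal.lintegral_mul_le_Lp_mul_Lq volume Real.HolderConjugate.two_two
          (by fun_prop) (by fun_prop)).trans_eq ?_
        simp_rw [e2]

end ClassicalGradient

/-- The Cauchy-Schwarz inequality against the constant function `1`. -/
theorem lintegral_sq_le {α : Type*} [MeasurableSpace α] {μ : Measure α} {f : α → ℝ≥0∞}
    (hf : AEMeasurable f μ) : (∫⁻ x, f x ∂μ) ^ 2 ≤ (∫⁻ x, f x ^ 2 ∂μ) * μ Set.univ := by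
  have := ENNReal.lintegral_mul_le_Lp_mul_Lq μ Real.HolderConjugate.two_two hf
    (aemeasurable_const (b := (1 : ℝ≥0∞)))
  simp only [Pi.mul_apply, mul_one, lintegral_const, ENNReal.rpow_two] at this
  refine (pow_le_pow_left' this 2).trans_eq ?_
  rw [mul_pow, ← ENNReal.rpow_two, ← ENNReal.rpow_two, ← ENNReal.rpow_mul, ← ENNReal.rpow_mul]
  norm_num

/-! ### The interpolation inequality for `C¹` functions with compact support. -/

section SphericalMean

theorem toSphere_univ_ne_zero {n : ℕ} (hn : 1 ≤ n) :
    (volume : Measure (EuclideanSpace ℝ (Fin n))).toSphere Set.univ ≠ 0 := by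
  have : Nonempty (Fin n) := ⟨⟨0, hn⟩⟩
  exact (Measure.measure_univ_ne_zero).2 (Measure.toSphere_ne_zero _)

theorem enorm_sphericalMean_sq_le {n : ℕ} (hn : 1 ≤ n) (h : EuclideanSpace ℝ (Fin n) → ℂ) (r : ℝ)
    (hm : AEStronglyMeasurable (fun u : Metric.sphere (0 : EuclideanSpace ℝ (Fin n)) 1 =>
      h (r • (u : EuclideanSpace ℝ (Fin n))))
      (volume : Measure (EuclideanSpace ℝ (Fin n))).toSphere) :
    ‖sphericalMean h r‖ₑ ^ 2 ≤
      ((volume : Measure (EuclideanSpace ℝ (Fin n))).toSphere Set.univ)⁻¹ *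
        ∫⁻ u : Metric.sphere (0 : EuclideanSpace ℝ (Fin n)) 1,
        ‖h (r • (u : EuclideanSpace ℝ (Fin n)))‖ₑ ^ 2
        ∂(volume : Measure (EuclideanSpace ℝ (Fin n))).toSphere := by
  have h0 := toSphere_univ_ne_zero hn
  set σ := (volume : Measure (EuclideanSpace ℝ (Fin n))).toSphere
  have htop : σ Set.univ ≠ ⊤ := measure_ne_top _ _
  have e1 : ‖(σ.real Set.univ)⁻¹‖ₑ = (σ Set.univ)⁻¹ := by
    have : 0 < σ.real Set.univ := ENNReal.toReal_pos h0 htop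
    rw [Real.enorm_of_nonneg (by positivity), ENNReal.ofReal_inv_of_pos this, ofReal_measureReal]
  rw [sphericalMean, enorm_smul, mul_pow, e1]
  calc _ ≤ (σ Set.univ)⁻¹ ^ 2 * ((∫⁻ u : Metric.sphere (0 : EuclideanSpace ℝ (Fin n)) 1,
      ‖h (r • (u : EuclideanSpace ℝ (Fin n)))‖ₑ ^ 2 ∂σ) * σ Set.univ) := by
        gcongr
        exact (pow_le_pow_left' (enorm_integral_le_lintegral_enorm _) 2).trans
          (lintegral_sq_le hm.enorm)
    _ = (σ Set.univ)⁻¹ * ((σ Set.univ)⁻¹ * σ Set.univ) * ∫⁻ u : Metric.sphere (0 : EuclideanSpace ℝ (Fin n)) 1,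
      ‖h (r • (u : EuclideanSpace ℝ (Fin n)))‖ₑ ^ 2 ∂σ := by ring
    _ = _ := by rw [ENNReal.inv_mul_cancel h0 htop, mul_one]

theorem eLpNorm_two_sq {α F : Type*} [MeasurableSpace α] [NormedAddCommGroup F] (f : α → F)
    (μ : Measure α) : eLpNorm f 2 μ ^ 2 = ∫⁻ x, ‖f x‖ₑ ^ 2 ∂μ := by
  simpa using eLpNorm_nnreal_pow_eq_lintegral (f := f) (μ := μ) (p := 2) two_ne_zero

theorem eLpNorm_divNorm_sq {n : ℕ} (f : EuclideanSpace ℝ (Fin n) → ℂ) :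
    eLpNorm (divNorm f) 2 volume ^ 2 = ∫⁻ x, ENNReal.ofReal (‖f x‖ ^ 2 / ‖x‖ ^ 2) := by
  rw [eLpNorm_two_sq]
  refine lintegral_congr fun x => ?_
  rw [← ofReal_norm, ← ENNReal.ofReal_pow (norm_nonneg _), divNorm, norm_div, div_pow]
  simp

variable {m : ℕ} {h : EuclideanSpace ℝ (Fin (m + 3)) → ℂ}

theorem eLpNorm_sphericalMean_sq_le (hh : ContDiff ℝ 1 h) (hs : HasCompactSupport h) :
    eLpNorm (fun r : Set.Ioi (0 : ℝ) => sphericalMean h (r : ℝ)) (sobolevExponent (m + 3))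
      (radialMeasure (m + 3)) ^ 2 ≤
    ((volume : Measure (EuclideanSpace ℝ (Fin (m + 3)))).toSphere Set.univ)⁻¹ *
      2 ^ (2 / ((m : ℝ) + 3)) * ((eLpNorm (divNorm (eulerOperator h)) 2 volume ^ 2) ^ (1 / ((m : ℝ) + 3)) *
        (eLpNorm (divNorm h) 2 volume ^ 2) ^ (1 - 1 / ((m : ℝ) + 3))) := by
  have hsup : ∀ r : ℝ, 0 < r → _ := fun r hr => lintegral_sphere_normSq_le hh hs hr
  have c2 := hh.continuous
  have hlt : ∀ r : ℝ, _ := fun r =>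
    enorm_sphericalMean_sq_le (by lia) h r (Continuous.aestronglyMeasurable (by fun_prop))
  have hB : (∫⁻ r : Set.Ioi (0 : ℝ), ENNReal.ofReal ((r : ℝ) ^ 2)⁻¹ *
      ∫⁻ u : Metric.sphere (0 : EuclideanSpace ℝ (Fin (m + 3))) 1,
        ‖h ((r : ℝ) • (u : EuclideanSpace ℝ (Fin (m + 3))))‖ₑ ^ 2
        ∂(volume : Measure (EuclideanSpace ℝ (Fin (m + 3)))).toSphere ∂(radialMeasure (m + 3))) =
        ∫⁻ x, ENNReal.ofReal (‖h x‖ ^ 2 / ‖x‖ ^ 2) := by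
    rw [lintegral_polar_symm (n := m + 3) (by lia) (by fun_prop)]
    refine lintegral_congr fun r => ?_
    rw [← lintegral_const_mul _ (Continuous.measurable (by fun_prop))]
    refine lintegral_congr fun u => ?_
    have hu : ‖(u : EuclideanSpace ℝ (Fin (m + 3)))‖ = 1 := by simp
    rw [norm_smul, hu, Real.norm_of_nonneg (le_of_lt r.2), mul_one, ← ofReal_norm,
      ← ENNReal.ofReal_pow (norm_nonneg _), ← ENNReal.ofReal_mul (inv_nonneg.2 (sq_nonneg _)),
      div_eq_inv_mul]
  rw [eLpNorm_divNorm_sq, eLpNorm_divNorm_sq]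
  have h0 := toSphere_univ_ne_zero (n := m + 3) (by lia)
  set σ := (volume : Measure (EuclideanSpace ℝ (Fin (m + 3)))).toSphere
  set A := ∫⁻ x, ENNReal.ofReal (‖eulerOperator h x‖ ^ 2 / ‖x‖ ^ 2)
  set B := ∫⁻ x, ENNReal.ofReal (‖h x‖ ^ 2 / ‖x‖ ^ 2)
  set s := (σ Set.univ)⁻¹
  set N : ℝ → ℝ≥0∞ := fun r => ∫⁻ u : Metric.sphere (0 : EuclideanSpace ℝ (Fin (m + 3))) 1,
        ‖h ((r : ℝ) • (u : EuclideanSpace ℝ (Fin (m + 3))))‖ₑ ^ 2 ∂σ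
  set K := 2 * (A ^ (1 / 2 : ℝ) * B ^ (1 / 2 : ℝ)) with hK
  -- Half the critical exponent, so `q - 1 = 2 / (m + 1)`.
  set q : ℝ := ((m : ℝ) + 3) / (m + 1) with hq
  have hq0 : 0 < q := by positivity
  have hp : sobolevExponent (m + 3) = ENNReal.ofReal (2 * q) := by
    rw [sobolevExponent]; congr 1; push_cast; rw [hq]; ring
  -- One factor `N r` is kept for integration; the other `q - 1` powers are bounded by `K * r ^ (-(m
  -- + 1))`, which produces exactly the Hardy weight `r ^ (-2)`.
  have hpt : ∀ r : Set.Ioi (0 : ℝ), ‖sphericalMean h (r : ℝ)‖ₑ ^ (2 * q) ≤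
      s ^ q * K ^ (2 / ((m : ℝ) + 1)) * (ENNReal.ofReal ((r : ℝ) ^ 2)⁻¹ * N r) := by
    rintro ⟨r, hr⟩
    have hr : 0 < r := hr
    have hNK : N r ≤ ENNReal.ofReal (r ^ (m + 1))⁻¹ * K := by
      rw [ENNReal.ofReal_inv_of_pos (by positivity), ← ENNReal.div_eq_inv_mul,
        ENNReal.le_div_iff_mul_le (by left; simp [hr]) (by simp), mul_comm]
      exact hsup r hr
    have hrr : ENNReal.ofReal (r ^ (m + 1))⁻¹ ^ (2 / ((m : ℝ) + 1)) = ENNReal.ofReal (r ^ 2)⁻¹ := by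
      rw [ENNReal.ofReal_rpow_of_nonneg (by positivity) (by positivity)]
      congr 1
      rw [Real.inv_rpow (by positivity), ← Real.rpow_natCast, ← Real.rpow_mul hr.le,
        ← Real.rpow_natCast]
      congr 2
      push_cast
      field_simp
    calc ‖sphericalMean h r‖ₑ ^ (2 * q) = (‖sphericalMean h r‖ₑ ^ 2) ^ q := by
          rw [ENNReal.rpow_mul, ENNReal.rpow_two]
      _ ≤ (s * N r) ^ q := ENNReal.rpow_le_rpow (hlt r) hq0.le
      _ = s ^ q * (N r ^ (2 / ((m : ℝ) + 1)) * N r) := by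
          rw [ENNReal.mul_rpow_of_nonneg _ _ hq0.le]
          congr 1
          conv_rhs => rw [← ENNReal.rpow_one (N r), ← ENNReal.rpow_mul]
          rw [← ENNReal.rpow_add_of_nonneg _ _ (by positivity) zero_le_one]
          congr 1
          rw [hq]; field_simp; ring
      _ ≤ s ^ q * ((ENNReal.ofReal (r ^ 2)⁻¹ * K ^ (2 / ((m : ℝ) + 1))) * N r) := by
          gcongr
          rw [← hrr, ← ENNReal.mul_rpow_of_nonneg _ _ (by positivity)]
          gcongr
      _ = _ := by ring
  have hint : ∫⁻ r : Set.Ioi (0 : ℝ), ‖sphericalMean h (r : ℝ)‖ₑ ^ (2 * q) ∂(radialMeasure (m + 3)) ≤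
      s ^ q * K ^ (2 / ((m : ℝ) + 1)) * B := by
    refine (lintegral_mono hpt).trans_eq ?_
    rw [← hB, lintegral_const_mul]
    refine Measurable.mul (by fun_prop) ?_
    refine Measurable.lintegral_prod_right' (f := fun (p : Set.Ioi (0 : ℝ) × Metric.sphere (0 : EuclideanSpace ℝ (Fin (m + 3))) 1) =>
      ‖h ((p.1 : ℝ) • (p.2 : EuclideanSpace ℝ (Fin (m + 3))))‖ₑ ^ 2) (Continuous.measurable (by fun_prop))
  rw [hp, eLpNorm_eq_lintegral_rpow_enorm_toReal (by simp [hq0]) ENNReal.ofReal_ne_top,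
    ENNReal.toReal_ofReal (by positivity), ← ENNReal.rpow_two, ← ENNReal.rpow_mul,
    show 1 / (2 * q) * 2 = 1 / q by field_simp]
  -- `K` now has exponent `2 / n`, giving `A` and `B` the power `1 / n` each; `B` gains `1 / q = 1 -
  -- 2 / n` more.
  refine (ENNReal.rpow_le_rpow hint (by positivity)).trans_eq ?_
  rw [ENNReal.mul_rpow_of_nonneg _ _ (by positivity), ENNReal.mul_rpow_of_nonneg _ _ (by positivity),
    ← ENNReal.rpow_mul, ← ENNReal.rpow_mul, mul_one_div_cancel hq0.ne', ENNReal.rpow_one,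
    show 2 / ((m : ℝ) + 1) * (1 / q) = 2 / ((m : ℝ) + 3) by rw [hq]; field_simp, hK,
    ENNReal.mul_rpow_of_nonneg _ _ (by positivity), ENNReal.mul_rpow_of_nonneg _ _ (by positivity),
    ← ENNReal.rpow_mul, ← ENNReal.rpow_mul,
    show 1 / 2 * (2 / ((m : ℝ) + 3)) = 1 / ((m : ℝ) + 3) by field_simp,
    show 1 - 1 / ((m : ℝ) + 3) = 1 / ((m : ℝ) + 3) + 1 / q by rw [hq]; field_simp; ring,
    ENNReal.rpow_add_of_nonneg _ _ (by positivity) (by positivity)]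
  ring

end SphericalMean

/-! ### Passage to the limit in `L²`. -/

section Approximation

open Filter Topology

theorem tendsto_eLpNorm_of_tendsto_sub {α F : Type*} [MeasurableSpace α] {μ : Measure α}
    [NormedAddCommGroup F] {f : ℕ → α → F} {g : α → F} (hf : ∀ k, AEStronglyMeasurable (f k) μ)
    (hg : MemLp g 2 μ) (h : Tendsto (fun k => eLpNorm (f k - g) 2 μ) atTop (𝓝 0)) :
    Tendsto (fun k => eLpNorm (f k) 2 μ) atTop (𝓝 (eLpNorm g 2 μ)) := by
  have h1 : Tendsto (fun k => eLpNorm g 2 μ - eLpNorm (f k - g) 2 μ) atTop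
      (𝓝 (eLpNorm g 2 μ)) := by
    simpa using ENNReal.Tendsto.sub tendsto_const_nhds h (Or.inl hg.2.ne)
  have h2 : Tendsto (fun k => eLpNorm g 2 μ + eLpNorm (f k - g) 2 μ) atTop
      (𝓝 (eLpNorm g 2 μ)) := by
    simpa using tendsto_const_nhds.add h
  refine tendsto_of_tendsto_of_tendsto_of_le_of_le h1 h2 (fun k => ?_) (fun k => ?_)
  · rw [tsub_le_iff_right]
    calc eLpNorm g 2 μ = eLpNorm (f k - (f k - g)) 2 μ := by rw [sub_sub_cancel]
      _ ≤ _ := eLpNorm_sub_le (hf k) ((hf k).sub hg.1) one_le_two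
  · calc eLpNorm (f k) 2 μ = eLpNorm (g + (f k - g)) 2 μ := by rw [add_sub_cancel]
      _ ≤ _ := eLpNorm_add_le hg.1 ((hf k).sub hg.1) one_le_two

theorem exists_subseq_tendsto_ae_of_eLpNorm {α F : Type*} [MeasurableSpace α] {μ : Measure α}
    [NormedAddCommGroup F] {f : ℕ → α → F} {g : α → F} (hf : ∀ k, AEStronglyMeasurable (f k) μ)
    (hg : AEStronglyMeasurable g μ) (h : Tendsto (fun k => eLpNorm (f k - g) 2 μ) atTop (𝓝 0)) :
    ∃ ns : ℕ → ℕ, StrictMono ns ∧ ∀ᵐ x ∂μ, Tendsto (fun k => f (ns k) x) atTop (𝓝 (g x)) :=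
  (tendstoInMeasure_of_tendsto_eLpNorm two_ne_zero hf hg h).exists_seq_tendsto_ae

/-- The sequence `H` of `C¹` functions with compact support converges to `h`, and the gradients
converge to `g`, in `L²`. -/
structure ApproximatesInSobolev {n : ℕ} (H : ℕ → EuclideanSpace ℝ (Fin n) → ℂ)
    (h : EuclideanSpace ℝ (Fin n) → ℂ)
    (g : EuclideanSpace ℝ (Fin n) → EuclideanSpace ℂ (Fin n)) : Prop where
  contDiff : ∀ k, ContDiff ℝ 1 (H k)
  hasCompactSupport : ∀ k, HasCompactSupport (H k)
  tendsto : Tendsto (fun k => eLpNorm (H k - h) 2 volume) atTop (𝓝 0)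
  tendsto_gradient : Tendsto (fun k => eLpNorm (complexGradient (H k) - g) 2 volume) atTop (𝓝 0)

theorem complexGradient_sub {n : ℕ} {f g : EuclideanSpace ℝ (Fin n) → ℂ} (hf : ContDiff ℝ 1 f)
    (hg : ContDiff ℝ 1 g) :
    complexGradient (f - g) = complexGradient f - complexGradient g := by
  ext x j
  simp [complexGradient, fderiv_sub (hf.differentiable one_ne_zero x)
    (hg.differentiable one_ne_zero x)]

theorem ContDiff.memLp_complexGradient {n : ℕ} {h : EuclideanSpace ℝ (Fin n) → ℂ}
    (hh : ContDiff ℝ 1 h) (hs : HasCompactSupport h) : MemLp (complexGradient h) 2 volume :=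
  (continuous_complexGradient hh).memLp_of_hasCompactSupport (hasCompactSupport_complexGradient hs)

theorem aestronglyMeasurable_divNorm {n : ℕ} {h : EuclideanSpace ℝ (Fin n) → ℂ}
    (hh : AEStronglyMeasurable h volume) : AEStronglyMeasurable (divNorm h) volume :=
  (hh.mul (Complex.measurable_ofReal.comp measurable_norm).inv.aestronglyMeasurable).congr
    (.of_forall fun _ => (div_eq_mul_inv _ _).symm)

variable {m : ℕ} {h : EuclideanSpace ℝ (Fin (m + 3)) → ℂ}
  {g : EuclideanSpace ℝ (Fin (m + 3)) → EuclideanSpace ℂ (Fin (m + 3))}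
  {H : ℕ → EuclideanSpace ℝ (Fin (m + 3)) → ℂ}

theorem eLpNorm_hardy_with_remainder (hh : ContDiff ℝ 1 h) (hs : HasCompactSupport h) :
    eLpNorm (divNorm (eulerOperator h)) 2 volume ^ 2 +
      ENNReal.ofReal (((m + 1) / 2 : ℝ) ^ 2) * eLpNorm (divNorm h) 2 volume ^ 2 ≤
      eLpNorm (complexGradient h) 2 volume ^ 2 := by
  rw [eLpNorm_divNorm_sq, eLpNorm_divNorm_sq]
  refine (hardy_with_remainder hh hs).trans_eq ?_
  rw [eLpNorm_two_sq]
  refine lintegral_congr fun x => ?_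
  rw [← ofReal_norm, ENNReal.ofReal_pow (norm_nonneg _)]

theorem ContDiff.eLpNorm_divNorm_le (hh : ContDiff ℝ 1 h) (hs : HasCompactSupport h) :
    eLpNorm (divNorm h) 2 volume ≤
      (ENNReal.ofReal ((m + 1) / 2 : ℝ))⁻¹ * eLpNorm (complexGradient h) 2 volume := by
  have h1 := le_add_self.trans (eLpNorm_hardy_with_remainder hh hs)
  rw [ENNReal.ofReal_pow (by positivity), ← mul_pow,
    ENNReal.pow_le_pow_left_iff two_ne_zero] at h1
  rw [← ENNReal.div_eq_inv_mul, ENNReal.le_div_iff_mul_le (Or.inl ?_) (Or.inl ENNReal.ofReal_ne_top),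
    mul_comm]
  · exact h1
  · simp only [ne_eq, ENNReal.ofReal_eq_zero, not_le]
    positivity

namespace ApproximatesInSobolev

/-- Hardy's inequality. -/
theorem eLpNorm_divNorm_le (hH : ApproximatesInSobolev H h g) (hh : AEStronglyMeasurable h volume)
    (hg : MemLp g 2 volume) :
    eLpNorm (divNorm h) 2 volume ≤
      (ENNReal.ofReal ((m + 1) / 2 : ℝ))⁻¹ * eLpNorm g 2 volume := by
  have hHm : ∀ k, AEStronglyMeasurable (H k) volume := fun k =>
    (hH.contDiff k).continuous.aestronglyMeasurable
  obtain ⟨ns, hns, hae⟩ := exists_subseq_tendsto_ae_of_eLpNorm hHm hh hH.tendsto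
  have hc : (ENNReal.ofReal ((m + 1) / 2 : ℝ))⁻¹ ≠ ⊤ := by
    simp only [ne_eq, ENNReal.inv_eq_top, ENNReal.ofReal_eq_zero, not_le]
    positivity
  have hlim := ENNReal.Tendsto.const_mul ((tendsto_eLpNorm_of_tendsto_sub
    (fun k => (continuous_complexGradient (hH.contDiff k)).aestronglyMeasurable) hg
    hH.tendsto_gradient).comp hns.tendsto_atTop) (Or.inr hc)
  refine (Lp.eLpNorm_lim_le_liminf_eLpNorm (f := fun k => divNorm (H (ns k)))
    (fun k => aestronglyMeasurable_divNorm (hHm _)) _ ?_).trans ?_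
  · filter_upwards [hae] with x hx
    exact hx.div_const _
  · rw [← hlim.liminf_eq]
    exact liminf_le_liminf (Eventually.of_forall fun k =>
      (hH.contDiff _).eLpNorm_divNorm_le (hH.hasCompactSupport _))

theorem memLp_divNorm (hH : ApproximatesInSobolev H h g) (hh : AEStronglyMeasurable h volume)
    (hg : MemLp g 2 volume) : MemLp (divNorm h) 2 volume := by
  refine ⟨aestronglyMeasurable_divNorm hh, (hH.eLpNorm_divNorm_le hh hg).trans_lt ?_⟩
  refine ENNReal.mul_lt_top ?_ hg.2
  simp only [ENNReal.inv_lt_top, ENNReal.ofReal_pos]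
  positivity

/-- Hardy's inequality is applied to `H k - h`, which is itself approximated by `H k - H j` as `j`
grows. -/
theorem tendsto_divNorm (hH : ApproximatesInSobolev H h g) (hh : AEStronglyMeasurable h volume)
    (hg : MemLp g 2 volume) :
    Tendsto (fun k => eLpNorm (divNorm (H k) - divNorm h) 2 volume) atTop (𝓝 0) := by
  have hc : (ENNReal.ofReal ((m + 1) / 2 : ℝ))⁻¹ ≠ ⊤ := by
    simp only [ne_eq, ENNReal.inv_eq_top, ENNReal.ofReal_eq_zero, not_le]
    positivity
  have hlim := ENNReal.Tendsto.const_mul hH.tendsto_gradient (Or.inr hc)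
  rw [mul_zero] at hlim
  refine tendsto_of_tendsto_of_tendsto_of_le_of_le tendsto_const_nhds hlim (fun k => zero_le)
    fun k => ?_
  have hk : ApproximatesInSobolev (fun j => H k - H j) (H k - h) (complexGradient (H k) - g) := by
    refine ⟨fun j => (hH.contDiff k).sub (hH.contDiff j),
      fun j => (hH.hasCompactSupport k).sub (hH.hasCompactSupport j), ?_, ?_⟩
    · simp_rw [sub_sub_sub_cancel_left, eLpNorm_sub_comm h]
      exact hH.tendsto
    · simp_rw [complexGradient_sub (hH.contDiff k) (hH.contDiff _), sub_sub_sub_cancel_left,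
        eLpNorm_sub_comm g]
      exact hH.tendsto_gradient
  have := hk.eLpNorm_divNorm_le ((hH.contDiff k).continuous.aestronglyMeasurable.sub hh)
    (((hH.contDiff k).memLp_complexGradient (hH.hasCompactSupport k)).sub hg)
  refine le_trans (le_of_eq ?_) this
  congr 1
  ext x
  simp [divNorm, sub_div]

end ApproximatesInSobolev

theorem ae_aestronglyMeasurable_sphere {n : ℕ} (hn : 1 ≤ n) {F : Type*} [NormedAddCommGroup F]
    {f : EuclideanSpace ℝ (Fin n) → F} (hf : AEStronglyMeasurable f volume) :
    ∀ᵐ r : Set.Ioi (0 : ℝ) ∂(radialMeasure n),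
      AEStronglyMeasurable (fun u : Metric.sphere (0 : EuclideanSpace ℝ (Fin n)) 1 =>
        f ((r : ℝ) • (u : EuclideanSpace ℝ (Fin n))))
        (volume : Measure (EuclideanSpace ℝ (Fin n))).toSphere := by
  have : SFinite (radialMeasure n) := by unfold radialMeasure; infer_instance
  exact (hf.comp_measurePreserving (measurePreserving_polar hn)).prod_swap.prodMk_left

/-- The restriction of an `L²` function to almost every sphere is in `L²`. -/
theorem ae_memLp_sphere {n : ℕ} (hn : 1 ≤ n) {F : Type*} [NormedAddCommGroup F]
    {f : EuclideanSpace ℝ (Fin n) → F} (hf : MemLp f 2 volume) :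
    ∀ᵐ r : Set.Ioi (0 : ℝ) ∂(radialMeasure n),
      MemLp (fun u : Metric.sphere (0 : EuclideanSpace ℝ (Fin n)) 1 =>
        f ((r : ℝ) • (u : EuclideanSpace ℝ (Fin n)))) 2
        (volume : Measure (EuclideanSpace ℝ (Fin n))).toSphere := by
  have : SFinite (radialMeasure n) := by unfold radialMeasure; infer_instance
  have h1 : ∫⁻ x, ‖f x‖ₑ ^ 2 < ⊤ := by
    rw [← eLpNorm_two_sq f]; exact ENNReal.pow_lt_top hf.2
  rw [lintegral_polar_symm hn (hf.1.enorm.pow_const 2)] at h1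
  have h3 : AEMeasurable (fun r : Set.Ioi (0 : ℝ) =>
      ∫⁻ u : Metric.sphere (0 : EuclideanSpace ℝ (Fin n)) 1,
        ‖f ((r : ℝ) • (u : EuclideanSpace ℝ (Fin n)))‖ₑ ^ 2
        ∂(volume : Measure (EuclideanSpace ℝ (Fin n))).toSphere) (radialMeasure n) :=
    ((hf.1.comp_measurePreserving
      (measurePreserving_polar hn)).prod_swap.enorm.pow_const 2).lintegral_prod_right'
  have h2 := ae_lt_top' h3 h1.ne
  filter_upwards [ae_aestronglyMeasurable_sphere hn hf.1, h2] with r hr1 hr2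
  refine ⟨hr1, ?_⟩
  rw [← eLpNorm_two_sq (fun u : Metric.sphere (0 : EuclideanSpace ℝ (Fin n)) 1 =>
        f ((r : ℝ) • (u : EuclideanSpace ℝ (Fin n))))] at hr2
  exact (ENNReal.pow_lt_top_iff.1 hr2).resolve_right two_ne_zero

theorem aestronglyMeasurable_sphericalMean {n : ℕ} (hn : 1 ≤ n) {f : EuclideanSpace ℝ (Fin n) → ℂ}
    (hf : AEStronglyMeasurable f volume) :
    AEStronglyMeasurable (fun r : Set.Ioi (0 : ℝ) => sphericalMean f (r : ℝ)) (radialMeasure n) := by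
  have : SFinite (radialMeasure n) := by unfold radialMeasure; infer_instance
  have h1 : AEStronglyMeasurable (fun r : Set.Ioi (0 : ℝ) =>
      ∫ u : Metric.sphere (0 : EuclideanSpace ℝ (Fin n)) 1,
        f ((r : ℝ) • (u : EuclideanSpace ℝ (Fin n)))
        ∂(volume : Measure (EuclideanSpace ℝ (Fin n))).toSphere) (radialMeasure n) :=
    (hf.comp_measurePreserving (measurePreserving_polar hn)).prod_swap.integral_prod_right'
  exact h1.const_smul ((volume : Measure (EuclideanSpace ℝ (Fin n))).toSphere.real Set.univ)⁻¹

/-- The spherical mean is a bounded operator on `L²`. -/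
theorem eLpNorm_sphericalMean_le {n : ℕ} (hn : 1 ≤ n) {f : EuclideanSpace ℝ (Fin n) → ℂ}
    (hf : AEStronglyMeasurable f volume) :
    eLpNorm (fun r : Set.Ioi (0 : ℝ) => sphericalMean f (r : ℝ)) 2 (radialMeasure n) ^ 2 ≤
      ((volume : Measure (EuclideanSpace ℝ (Fin n))).toSphere Set.univ)⁻¹ *
        eLpNorm f 2 volume ^ 2 := by
  have h0 := toSphere_univ_ne_zero hn
  rw [eLpNorm_two_sq, eLpNorm_two_sq, lintegral_polar_symm hn (hf.enorm.pow_const 2),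
    ← lintegral_const_mul' _ _ (ENNReal.inv_ne_top.2 h0)]
  refine lintegral_mono_ae ?_
  filter_upwards [ae_aestronglyMeasurable_sphere hn hf] with r hr
  exact enorm_sphericalMean_sq_le hn f r hr

theorem sphericalMean_sub {n : ℕ} {f₁ f₂ : EuclideanSpace ℝ (Fin n) → ℂ} {r : ℝ}
    (h₁ : Integrable (fun u : Metric.sphere (0 : EuclideanSpace ℝ (Fin n)) 1 =>
        f₁ (r • (u : EuclideanSpace ℝ (Fin n))))
        (volume : Measure (EuclideanSpace ℝ (Fin n))).toSphere)
    (h₂ : Integrable (fun u : Metric.sphere (0 : EuclideanSpace ℝ (Fin n)) 1 =>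
        f₂ (r • (u : EuclideanSpace ℝ (Fin n))))
        (volume : Measure (EuclideanSpace ℝ (Fin n))).toSphere) :
    sphericalMean (f₁ - f₂) r = sphericalMean f₁ r - sphericalMean f₂ r := by
  simp only [sphericalMean, Pi.sub_apply]
  rw [integral_sub h₁ h₂, smul_sub]

/-- The mean is additive on almost every sphere, where both functions are integrable, and is bounded
on `L²`. The limit later supplies an almost everywhere convergent subsequence. -/
theorem tendsto_eLpNorm_sphericalMean {n : ℕ} (hn : 1 ≤ n) {f : EuclideanSpace ℝ (Fin n) → ℂ}
    {F : ℕ → EuclideanSpace ℝ (Fin n) → ℂ} (hF : ∀ k, MemLp (F k) 2 volume) (hf : MemLp f 2 volume)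
    (h : Tendsto (fun k => eLpNorm (F k - f) 2 volume) atTop (𝓝 0)) :
    Tendsto (fun k => eLpNorm ((fun r : Set.Ioi (0 : ℝ) => sphericalMean (F k) (r : ℝ)) -
      fun r : Set.Ioi (0 : ℝ) => sphericalMean f (r : ℝ)) 2 (radialMeasure n)) atTop (𝓝 0) := by
  have h0 := toSphere_univ_ne_zero hn
  have h1 : Tendsto (fun k => (((volume : Measure (EuclideanSpace ℝ (Fin n))).toSphere Set.univ)⁻¹ *
        eLpNorm (F k - f) 2 volume ^ 2) ^ (1 / 2 : ℝ)) atTop (𝓝 0) := by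
    have := (ENNReal.Tendsto.const_mul (ENNReal.Tendsto.pow (n := 2) h)
      (Or.inr (ENNReal.inv_ne_top.2 h0))).ennrpow_const (1 / 2)
    simpa using this
  refine tendsto_of_tendsto_of_tendsto_of_le_of_le tendsto_const_nhds h1 (fun k => zero_le)
    fun k => ?_
  have e : eLpNorm ((fun r : Set.Ioi (0 : ℝ) => sphericalMean (F k) (r : ℝ)) -
      fun r : Set.Ioi (0 : ℝ) => sphericalMean f (r : ℝ)) 2 (radialMeasure n) =
      eLpNorm (fun r : Set.Ioi (0 : ℝ) => sphericalMean (F k - f) (r : ℝ)) 2 (radialMeasure n) := by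
    refine eLpNorm_congr_ae ?_
    filter_upwards [ae_memLp_sphere hn (hF k), ae_memLp_sphere hn hf] with r h₁ h₂
    exact (sphericalMean_sub (h₁.integrable one_le_two) (h₂.integrable one_le_two)).symm
  rw [e]
  calc _ = (eLpNorm (fun r : Set.Ioi (0 : ℝ) => sphericalMean (F k - f) (r : ℝ)) 2
        (radialMeasure n) ^ 2) ^ (1 / 2 : ℝ) := by
        rw [← ENNReal.rpow_two, ← ENNReal.rpow_mul]; norm_num
    _ ≤ _ := by
      gcongr
      exact eLpNorm_sphericalMean_le hn ((hF k).sub hf).1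

end Approximation

/-! ### Mollifiers converge in `L²`. -/

section Mollification

open Filter Topology Convolution

variable {E F : Type*} [NormedAddCommGroup E] [InnerProductSpace ℝ E] [FiniteDimensional ℝ E]
  [MeasurableSpace E] [BorelSpace E] [NormedAddCommGroup F]

theorem tendsto_eLpNorm_translate_sub {f : E → F} (hf : MemLp f 2 volume) :
    Tendsto (fun y => eLpNorm (fun x => f (x - y) - f x) 2 volume) (𝓝 0) (𝓝 0) := by
  -- Translations depend continuously on `y` in the compact-open topology, which makes composition
  -- with them continuous into `L²`.
  let G : E → C(E, E) := fun y => ⟨fun x => x - y, by fun_prop⟩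
  have hG : Continuous G :=
    ((ContinuousMap.mk (fun p : E × E => p.2 - p.1) (by fun_prop)).curry).continuous
  have hm : ∀ y, MeasurePreserving (G y) (volume : Measure E) volume := fun y =>
    measurePreserving_sub_right volume y
  have hc : Continuous fun y => Lp.compMeasurePreserving (G y) (hm y) (hf.toLp f) :=
    Continuous.compMeasurePreservingLp continuous_const hG hm (by simp)
  have h0 := hc.tendsto 0
  rw [Lp.tendsto_Lp_iff_tendsto_eLpNorm'] at h0
  refine h0.congr fun y => eLpNorm_congr_ae ?_
  have h1 := (hm y).quasiMeasurePreserving.ae_eq_comp hf.coeFn_toLp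
  have h2 := (hm 0).quasiMeasurePreserving.ae_eq_comp hf.coeFn_toLp
  filter_upwards [h1, h2, Lp.coeFn_compMeasurePreserving (hf.toLp f) (hm y),
    Lp.coeFn_compMeasurePreserving (hf.toLp f) (hm 0)] with x h1 h2 h3 h4
  simp only [Pi.sub_apply, h3, h4, h1, h2]
  simp [G]

variable [NormedSpace ℝ F] [CompleteSpace F]

/-- The error is an average of `f (x - y) - f x` over `y` against the probability density of the
bump; Cauchy-Schwarz and Tonelli reduce it to translations with `y` in the support. -/
theorem eLpNorm_mollify_sub_le {f : E → F} (hf : MemLp f 2 volume) (φ : ContDiffBump (0 : E))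
    {δ : ℝ≥0∞} (hδ : ∀ y ∈ Metric.ball (0 : E) φ.rOut,
      eLpNorm (fun x => f (x - y) - f x) 2 volume ≤ δ) :
    eLpNorm (fun x => (φ.normed volume ⋆[ContinuousLinearMap.lsmul ℝ ℝ, volume] f) x - f x) 2 volume
      ≤ δ := by
  have hloc : LocallyIntegrable f volume := hf.locallyIntegrable one_le_two
  let ν : Measure E := volume.withDensity fun y => ‖φ.normed volume y‖ₑ
  have hν : ν Set.univ = 1 := by
    rw [withDensity_apply _ MeasurableSet.univ, setLIntegral_univ]
    simp_rw [Real.enorm_of_nonneg (φ.nonneg_normed _)]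
    rw [← ofReal_integral_eq_lintegral_ofReal φ.integrable_normed
      (Eventually.of_forall φ.nonneg_normed), φ.integral_normed, ENNReal.ofReal_one]
  have hfin : IsProbabilityMeasure ν := ⟨hν⟩
  have hφm : Measurable fun y => ‖φ.normed volume y‖ₑ := φ.continuous_normed.enorm.measurable
  have hmeas : AEStronglyMeasurable (fun p : E × E => f (p.1 - p.2) - f p.1)
      ((volume : Measure E).prod ν) := by
    have h1 : AEStronglyMeasurable (fun p : E × E => f (p.1 - p.2) - f p.1)
        ((volume : Measure E).prod volume) :=
      (hf.1.comp_quasiMeasurePreserving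
        (quasiMeasurePreserving_sub_of_right_invariant volume volume)).sub hf.1.comp_fst
    exact h1.mono_ac (Measure.AbsolutelyContinuous.rfl.prod (withDensity_absolutelyContinuous _ _))
  have hpt : ∀ x, ‖(φ.normed volume ⋆[ContinuousLinearMap.lsmul ℝ ℝ, volume] f) x - f x‖ₑ ≤
      ∫⁻ y, ‖f (x - y) - f x‖ₑ ∂ν := by
    intro x
    have hi : Integrable (fun y => φ.normed volume y • f (x - y)) volume :=
      φ.hasCompactSupport_normed.convolutionExists_left (ContinuousLinearMap.lsmul ℝ ℝ)
        φ.continuous_normed hloc x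
    have e : (φ.normed volume ⋆[ContinuousLinearMap.lsmul ℝ ℝ, volume] f) x - f x =
        ∫ y, φ.normed volume y • (f (x - y) - f x) := by
      simp_rw [smul_sub]
      rw [integral_sub hi (φ.integrable_normed.smul_const _), φ.integral_normed_smul,
        convolution_def]
      rfl
    rw [e, lintegral_withDensity_eq_lintegral_mul_non_measurable _ hφm
        (Eventually.of_forall fun _ => enorm_lt_top)]
    refine (enorm_integral_le_lintegral_enorm _).trans_eq (lintegral_congr fun y => ?_)
    rw [enorm_smul, Pi.mul_apply]
  have hsq : eLpNorm (fun x => (φ.normed volume ⋆[ContinuousLinearMap.lsmul ℝ ℝ, volume] f) x - f x)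
      2 volume ^ 2 ≤ δ ^ 2 := by
    rw [eLpNorm_two_sq]
    calc _ ≤ ∫⁻ x, (∫⁻ y, ‖f (x - y) - f x‖ₑ ^ 2 ∂ν) := by
          refine lintegral_mono_ae ?_
          filter_upwards [hmeas.prodMk_left] with x hx
          refine (pow_le_pow_left' (hpt x) 2).trans ?_
          simpa [hν] using lintegral_sq_le hx.enorm
      _ = ∫⁻ y, (∫⁻ x, ‖f (x - y) - f x‖ₑ ^ 2) ∂ν :=
          lintegral_lintegral_swap (hmeas.enorm.pow_const 2)
      _ ≤ ∫⁻ y, δ ^ 2 ∂ν := by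
          refine lintegral_mono_ae ?_
          rw [ae_withDensity_iff hφm]
          refine Eventually.of_forall fun y hy => ?_
          rw [← eLpNorm_two_sq]
          refine pow_le_pow_left' (hδ y ?_) 2
          rw [← φ.support_normed_eq (μ := volume)]
          simpa using hy
      _ = δ ^ 2 := by simp [hν]
  exact (ENNReal.pow_le_pow_left_iff two_ne_zero).1 hsq

theorem exists_bump_eLpNorm_mollify_sub_le {F' : Type*} [NormedAddCommGroup F'] [NormedSpace ℝ F']
    [CompleteSpace F'] {f : E → F} {g : E → F'}
    (hf : MemLp f 2 volume) (hg : MemLp g 2 volume) {ε : ℝ≥0∞} (hε : 0 < ε) :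
    ∃ φ : ContDiffBump (0 : E),
      eLpNorm (fun x => (φ.normed volume ⋆[ContinuousLinearMap.lsmul ℝ ℝ, volume] f) x - f x) 2
        volume ≤ ε ∧
      eLpNorm (fun x => (φ.normed volume ⋆[ContinuousLinearMap.lsmul ℝ ℝ, volume] g) x - g x) 2
        volume ≤ ε := by
  have h1 := (tendsto_eLpNorm_translate_sub hf).eventually (ge_mem_nhds hε)
  have h2 := (tendsto_eLpNorm_translate_sub hg).eventually (ge_mem_nhds hε)
  obtain ⟨δ, hδ, hb⟩ := Metric.eventually_nhds_iff_ball.1 (h1.and h2)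
  refine ⟨⟨δ / 2, δ, half_pos hδ, half_lt_self hδ⟩, ?_, ?_⟩
  · exact eLpNorm_mollify_sub_le hf _ fun y hy => (hb y hy).1
  · exact eLpNorm_mollify_sub_le hg _ fun y hy => (hb y hy).2

end Mollification

/-! ### Density of compactly supported `C¹` functions in `H¹`. -/

section Density

open Filter Topology Convolution

variable {n : ℕ}

/-- The classical gradient of a mollification is the mollification of the weak gradient. -/
theorem IsWeakGradient.complexGradient_mollify {h : EuclideanSpace ℝ (Fin n) → ℂ}
    {g : EuclideanSpace ℝ (Fin n) → EuclideanSpace ℂ (Fin n)} (hg : IsWeakGradient h g)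
    (φ : ContDiffBump (0 : EuclideanSpace ℝ (Fin n))) (x : EuclideanSpace ℝ (Fin n)) :
    complexGradient (φ.normed volume ⋆[ContinuousLinearMap.lsmul ℝ ℝ, volume] h) x =
      (φ.normed volume ⋆[ContinuousLinearMap.lsmul ℝ ℝ, volume] g) x := by
  have hc : ContDiff ℝ ∞ (φ.normed volume) := φ.contDiff_normed
  have hs : HasCompactSupport (φ.normed volume) := φ.hasCompactSupport_normed
  have hd := hs.hasFDerivAt_convolution_left (ContinuousLinearMap.lsmul ℝ ℝ) (hc.of_le (by simp))
    hg.locallyIntegrable x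
  have hi : Integrable (fun y => φ.normed volume y • g (x - y)) volume :=
      hs.convolutionExists_left (ContinuousLinearMap.lsmul ℝ ℝ) hc.continuous
        hg.locallyIntegrable_grad x
  have hi' := hs.fderiv (𝕜 := ℝ) |>.convolutionExists_left
    ((ContinuousLinearMap.lsmul ℝ ℝ : ℝ →L[ℝ] ℂ →L[ℝ] ℂ).precompL (EuclideanSpace ℝ (Fin n)))
    (hc.continuous_fderiv (by simp)) hg.locallyIntegrable x
  ext j
  -- The reflected bump is the test function; the sign from its chain rule cancels the one in the
  -- definition of the weak gradient.
  let ψ : EuclideanSpace ℝ (Fin n) → ℝ := fun y => φ.normed volume (x - y)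
  have hψc : ContDiff ℝ ∞ ψ := hc.comp (contDiff_const.sub contDiff_id)
  have hψs : HasCompactSupport ψ := hs.comp_homeomorph (Homeomorph.subLeft x)
  have hψd : ∀ y v, fderiv ℝ ψ y v = - fderiv ℝ (φ.normed volume) (x - y) v := by
    intro y v
    have h1 : HasFDerivAt (fun y => x - y) (-ContinuousLinearMap.id ℝ (EuclideanSpace ℝ (Fin n))) y :=
      (hasFDerivAt_id y).const_sub x
    have h2 := ((hc.differentiable (by simp) (x - y)).hasFDerivAt).comp y h1
    rw [show ψ = φ.normed volume ∘ fun y => x - y from rfl, h2.fderiv]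
    simp
  have hw := hg.integral_eq ψ hψc hψs j
  have e1 : complexGradient (φ.normed volume ⋆[ContinuousLinearMap.lsmul ℝ ℝ, volume] h) x j =
      ∫ y, fderiv ℝ (φ.normed volume) y (EuclideanSpace.single j 1) • h (x - y) := by
    simp only [complexGradient]
    rw [hd.fderiv, convolution_def, ContinuousLinearMap.integral_apply hi']
    rfl
  have e2 : (φ.normed volume ⋆[ContinuousLinearMap.lsmul ℝ ℝ, volume] g) x j =
      ∫ y, φ.normed volume y • g (x - y) j := by
    rw [convolution_def]
    exact ((EuclideanSpace.proj j : EuclideanSpace ℂ (Fin n) →L[ℂ] ℂ).restrictScalars ℝ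
      |>.integral_comp_comm hi).symm
  rw [e1, e2, ← integral_sub_left_eq_self (fun y => _ • h (x - y)) volume x,
    ← integral_sub_left_eq_self (fun y => _ • g (x - y) j) volume x]
  simp only [sub_sub_cancel]
  simp_rw [hψd, neg_smul, integral_neg] at hw
  exact neg_inj.1 hw

theorem exists_contDiff_eLpNorm_sub_le {h : EuclideanSpace ℝ (Fin n) → ℂ}
    {g : EuclideanSpace ℝ (Fin n) → EuclideanSpace ℂ (Fin n)} (hw : IsWeakGradient h g)
    (hh : MemLp h 2 volume) (hg : MemLp g 2 volume) {ε : ℝ≥0∞} (hε : 0 < ε) :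
    ∃ f, ContDiff ℝ 1 f ∧ eLpNorm (f - h) 2 volume ≤ ε ∧
      eLpNorm (complexGradient f - g) 2 volume ≤ ε := by
  obtain ⟨φ, h1, h2⟩ := exists_bump_eLpNorm_mollify_sub_le hh hg hε
  refine ⟨φ.normed volume ⋆[ContinuousLinearMap.lsmul ℝ ℝ, volume] h, ?_, h1, ?_⟩
  · exact φ.hasCompactSupport_normed.contDiff_convolution_left _ (n := 1) φ.contDiff_normed
      hw.locallyIntegrable
  · rw [show complexGradient _ = _ from funext (hw.complexGradient_mollify φ)]
    exact h2

theorem tendsto_eLpNorm_smul_sub {α F : Type*} [MeasurableSpace α] {μ : Measure α}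
    [NormedAddCommGroup F] [NormedSpace ℂ F] {f : α → F} {χ : ℕ → α → ℂ} (hf : MemLp f 2 μ)
    (hχm : ∀ k, AEStronglyMeasurable (χ k) μ) (hχ : ∀ k x, ‖χ k x‖ ≤ 1)
    (hlim : ∀ x, Tendsto (fun k => χ k x) atTop (𝓝 1)) :
    Tendsto (fun k => eLpNorm (fun x => χ k x • f x - f x) 2 μ) atTop (𝓝 0) := by
  have hb : ∀ k x, ‖χ k x • f x - f x‖ₑ ^ 2 ≤ (2 * ‖f x‖ₑ) ^ 2 := by
    intro k x
    gcongr
    rw [two_mul]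
    refine enorm_sub_le.trans ?_
    gcongr
    rw [enorm_smul]
    refine mul_le_of_le_one_left' ?_
    rw [← ofReal_norm]
    simpa using ENNReal.ofReal_le_ofReal (hχ k x)
  have h1 : Tendsto (fun k => ∫⁻ x, ‖χ k x • f x - f x‖ₑ ^ 2 ∂μ) atTop (𝓝 (∫⁻ x, 0 ∂μ)) := by
    refine tendsto_lintegral_of_dominated_convergence' (fun x => (2 * ‖f x‖ₑ) ^ 2)
      (fun k => (((hχm k).smul hf.1).sub hf.1).enorm.pow_const 2)
      (fun k => Eventually.of_forall (hb k)) ?_ (Eventually.of_forall fun x => ?_)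
    · simp_rw [mul_pow]
      rw [lintegral_const_mul' _ _ (by simp), ← eLpNorm_two_sq]
      exact ENNReal.mul_ne_top (by simp) (ENNReal.pow_ne_top hf.2.ne)
    · have h2 : Tendsto (fun k => χ k x • f x - f x) atTop (𝓝 0) := by
        simpa using ((hlim x).smul_const (f x)).sub_const (f x)
      simpa using (ENNReal.Tendsto.pow (n := 2) h2.enorm)
  have h3 := h1.ennrpow_const (1 / 2)
  simp only [lintegral_const, zero_mul] at h3
  rw [ENNReal.zero_rpow_of_pos (by norm_num)] at h3
  refine h3.congr fun k => ?_
  rw [← eLpNorm_two_sq, ← ENNReal.rpow_two, ← ENNReal.rpow_mul]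
  norm_num

theorem complexGradient_mul {χ f : EuclideanSpace ℝ (Fin n) → ℂ} (hχ : ContDiff ℝ 1 χ)
    (hf : ContDiff ℝ 1 f) (x : EuclideanSpace ℝ (Fin n)) :
    complexGradient (fun y => χ y * f y) x =
      χ x • complexGradient f x + f x • complexGradient χ x := by
  ext j
  simp [complexGradient, fderiv_fun_mul (hχ.differentiable one_ne_zero x)
    (hf.differentiable one_ne_zero x)]

theorem complexGradient_comp_smul {χ : EuclideanSpace ℝ (Fin n) → ℂ}
    (c : ℝ) (x : EuclideanSpace ℝ (Fin n)) :
    complexGradient (fun y => χ (c • y)) x = (c : ℂ) • complexGradient χ (c • x) := by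
  ext j
  simp [complexGradient, fderiv_comp_smul]

/-- A `C¹` function in `H¹` can be cut off. -/
theorem exists_hasCompactSupport_eLpNorm_sub_le {f : EuclideanSpace ℝ (Fin n) → ℂ}
    (hf : ContDiff ℝ 1 f) (hf2 : MemLp f 2 volume) (hg : MemLp (complexGradient f) 2 volume)
    {ε : ℝ≥0∞} (hε : 0 < ε) :
    ∃ f', ContDiff ℝ 1 f' ∧ HasCompactSupport f' ∧ eLpNorm (f' - f) 2 volume ≤ ε ∧
      eLpNorm (complexGradient f' - complexGradient f) 2 volume ≤ ε := by
  let b : ContDiffBump (0 : EuclideanSpace ℝ (Fin n)) := ⟨1, 2, one_pos, one_lt_two⟩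
  let χ : EuclideanSpace ℝ (Fin n) → ℂ := fun x => (b x : ℂ)
  have hχ : ContDiff ℝ 1 χ := Complex.ofRealCLM.contDiff.comp b.contDiff
  have hχs : HasCompactSupport χ := b.hasCompactSupport.comp_left (g := fun x : ℝ => (x : ℂ)) rfl
  have hχ1 : ∀ x, ‖χ x‖ ≤ 1 := fun x => by
    simp only [χ, Complex.norm_real, Real.norm_of_nonneg b.nonneg]
    exact b.le_one
  obtain ⟨M, hM⟩ := (hasCompactSupport_complexGradient hχs).exists_bound_of_continuous
    (continuous_complexGradient hχ)
  have hM0 : 0 ≤ M := (norm_nonneg _).trans (hM 0)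
  let c : ℕ → ℝ := fun k => 1 / ((k : ℝ) + 1)
  have hc0 : ∀ k, 0 < c k := fun k => by positivity
  have hc : Tendsto c atTop (𝓝 0) := tendsto_one_div_add_atTop_nhds_zero_nat
  let X : ℕ → EuclideanSpace ℝ (Fin n) → ℂ := fun k x => χ (c k • x)
  have hX : ∀ k, ContDiff ℝ 1 (X k) := fun k => hχ.comp (contDiff_const_smul _)
  have hXs : ∀ k, HasCompactSupport (X k) := fun k => hχs.comp_smul (hc0 k).ne'
  have hXlim : ∀ x, Tendsto (fun k => X k x) atTop (𝓝 1) := by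
    intro x
    have h1 : Tendsto (fun k => c k • x) atTop (𝓝 0) := by simpa using hc.smul_const x
    have h2 := (hχ.continuous.tendsto 0).comp h1
    have h3 : χ 0 = 1 := by
      have : b 0 = 1 := b.one_of_mem_closedBall (by simp [b])
      simp [χ, this]
    rw [h3] at h2
    exact h2
  have t1 := tendsto_eLpNorm_smul_sub hf2 (fun k => (hX k).continuous.aestronglyMeasurable)
    (fun k x => hχ1 _) hXlim
  have t2 := tendsto_eLpNorm_smul_sub hg (fun k => (hX k).continuous.aestronglyMeasurable)
    (fun k x => hχ1 _) hXlim
  have t3 : Tendsto (fun k => ENNReal.ofReal (c k * M) * eLpNorm f 2 volume) atTop (𝓝 0) := by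
    have : Tendsto (fun k => ENNReal.ofReal (c k * M)) atTop (𝓝 0) := by
      simpa using ENNReal.tendsto_ofReal (hc.mul_const M)
    simpa using ENNReal.Tendsto.mul_const this (Or.inr hf2.2.ne)
  have t4 := t2.add t3
  rw [add_zero] at t4
  obtain ⟨k, hk1, hk2⟩ := ((t1.eventually (ge_mem_nhds hε)).and
    (t4.eventually (ge_mem_nhds hε))).exists
  refine ⟨fun x => X k x * f x, (hX k).mul hf, (hXs k).mul_right, hk1, le_trans ?_ hk2⟩
  -- The first term tends to `0` by dominated convergence; the second is at most `c k * M * ‖f‖`, as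
  -- dilation scales the gradient of the cutoff by `c k`.
  have e : complexGradient (fun x => X k x * f x) - complexGradient f =
      (fun x => X k x • complexGradient f x - complexGradient f x) +
        fun x => f x • complexGradient (X k) x := by
    ext1 x
    simp only [Pi.sub_apply, Pi.add_apply, complexGradient_mul (hX k) hf]
    abel
  rw [e]
  have m1 := continuous_complexGradient hf
  have m2 := continuous_complexGradient (hX k)
  have m3 := (hX k).continuous
  have m4 := hf.continuous
  refine (eLpNorm_add_le (by fun_prop) (by fun_prop) one_le_two).trans ?_
  gcongr
  refine eLpNorm_le_mul_eLpNorm_of_ae_le_mul (Eventually.of_forall fun x => ?_) 2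
  rw [norm_smul, complexGradient_comp_smul, norm_smul, Complex.norm_real,
    Real.norm_of_nonneg (hc0 k).le, mul_comm]
  have := hc0 k
  gcongr
  exact hM _

/-- Functions of class `C¹` with compact support are dense in the Sobolev space `H¹`. -/
theorem IsWeakGradient.exists_approximatesInSobolev {h : EuclideanSpace ℝ (Fin n) → ℂ}
    {g : EuclideanSpace ℝ (Fin n) → EuclideanSpace ℂ (Fin n)} (hw : IsWeakGradient h g)
    (hh : MemLp h 2 volume) (hg : MemLp g 2 volume) :
    ∃ H, ApproximatesInSobolev H h g := by
  have key : ∀ ε : ℝ≥0∞, 0 < ε → ε ≠ ⊤ → ∃ f, ContDiff ℝ 1 f ∧ HasCompactSupport f ∧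
      eLpNorm (f - h) 2 volume ≤ ε + ε ∧ eLpNorm (complexGradient f - g) 2 volume ≤ ε + ε := by
    intro ε hε hεt
    obtain ⟨f₁, hf₁, a₁, b₁⟩ := exists_contDiff_eLpNorm_sub_le hw hh hg hε
    have mf : AEStronglyMeasurable f₁ volume := hf₁.continuous.aestronglyMeasurable
    have mg : AEStronglyMeasurable (complexGradient f₁) volume :=
      (continuous_complexGradient hf₁).aestronglyMeasurable
    have hf₁2 : MemLp f₁ 2 volume := by
      have : MemLp (f₁ - h) 2 volume := ⟨mf.sub hh.1, a₁.trans_lt hεt.lt_top⟩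
      simpa using this.add hh
    have hg₁2 : MemLp (complexGradient f₁) 2 volume := by
      have : MemLp (complexGradient f₁ - g) 2 volume := ⟨mg.sub hg.1, b₁.trans_lt hεt.lt_top⟩
      simpa using this.add hg
    obtain ⟨f, hf, hs, a, b⟩ := exists_hasCompactSupport_eLpNorm_sub_le hf₁ hf₁2 hg₁2 hε
    refine ⟨f, hf, hs, ?_, ?_⟩
    · rw [← sub_add_sub_cancel f f₁ h]
      exact (eLpNorm_add_le (hf.continuous.aestronglyMeasurable.sub mf) (mf.sub hh.1)
        one_le_two).trans (add_le_add a a₁)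
    · rw [← sub_add_sub_cancel (complexGradient f) (complexGradient f₁) g]
      exact (eLpNorm_add_le ((continuous_complexGradient hf).aestronglyMeasurable.sub mg)
        (mg.sub hg.1) one_le_two).trans (add_le_add b b₁)
  have lim : Tendsto (fun k : ℕ => ((k : ℝ≥0∞))⁻¹ + ((k : ℝ≥0∞))⁻¹) atTop (𝓝 0) := by
    simpa using ENNReal.tendsto_inv_nat_nhds_zero.add ENNReal.tendsto_inv_nat_nhds_zero
  have lim' := (tendsto_add_atTop_iff_nat 1).2 lim
  -- The shift to `k + 1` keeps the tolerance finite at `k = 0`.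
  choose H h1 h2 h3 h4 using fun k : ℕ => key (((k + 1 : ℕ) : ℝ≥0∞))⁻¹ (by simp) (by simp)
  exact ⟨H, h1, h2,
    tendsto_of_tendsto_of_tendsto_of_le_of_le tendsto_const_nhds lim' (fun _ => zero_le) h3,
    tendsto_of_tendsto_of_tendsto_of_le_of_le tendsto_const_nhds lim' (fun _ => zero_le) h4⟩

end Density

/-! ### Extension to `H¹` and the two inequalities. -/

section Main

open Filter Topology

theorem ofReal_l2NormSq {n : ℕ} {F : Type*} [NormedAddCommGroup F]
    {f : EuclideanSpace ℝ (Fin n) → F} (hf : MemLp f 2 volume) :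
    ENNReal.ofReal (l2NormSq f) = eLpNorm f 2 volume ^ 2 := by
  rw [l2NormSq, ENNReal.ofReal_pow ENNReal.toReal_nonneg, ENNReal.ofReal_toReal hf.2.ne]

theorem l2NormSq_nonneg {n : ℕ} {F : Type*} [NormedAddCommGroup F]
    (f : EuclideanSpace ℝ (Fin n) → F) : 0 ≤ l2NormSq f := sq_nonneg _

theorem tendsto_l2NormSq {n : ℕ} {F : Type*} [NormedAddCommGroup F]
    {f : ℕ → EuclideanSpace ℝ (Fin n) → F} {g : EuclideanSpace ℝ (Fin n) → F}
    (hf : ∀ k, AEStronglyMeasurable (f k) volume) (hg : MemLp g 2 volume)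
    (h : Tendsto (fun k => eLpNorm (f k - g) 2 volume) atTop (𝓝 0)) :
    Tendsto (fun k => l2NormSq (f k)) atTop (𝓝 (l2NormSq g)) :=
  ((ENNReal.tendsto_toReal hg.2.ne).comp (tendsto_eLpNorm_of_tendsto_sub hf hg h)).pow 2

/-- The constant in the interpolation inequality for spherical means in dimension `m + 3`. -/
noncomputable def interpolationConst (m : ℕ) : ℝ≥0∞ :=
  ((volume : Measure (EuclideanSpace ℝ (Fin (m + 3)))).toSphere Set.univ)⁻¹ *
      2 ^ (2 / ((m : ℝ) + 3))

theorem interpolationConst_ne_top (m : ℕ) : interpolationConst m ≠ ⊤ :=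
  ENNReal.mul_ne_top (ENNReal.inv_ne_top.2 (toSphere_univ_ne_zero (by lia)))
    (ENNReal.rpow_ne_top_of_nonneg (by positivity) (by simp))

theorem interpolationConst_ne_zero (m : ℕ) : interpolationConst m ≠ 0 :=
  mul_ne_zero (ENNReal.inv_ne_zero.2 (measure_ne_top _ _))
    (ENNReal.rpow_pos (by simp) (by simp)).ne'

variable {m : ℕ} {h : EuclideanSpace ℝ (Fin (m + 3)) → ℂ}
  {g : EuclideanSpace ℝ (Fin (m + 3)) → EuclideanSpace ℂ (Fin (m + 3))}
  {H : ℕ → EuclideanSpace ℝ (Fin (m + 3)) → ℂ}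

theorem ContDiff.memLp_divNorm (hh : ContDiff ℝ 1 h) (hs : HasCompactSupport h) :
    MemLp (divNorm h) 2 volume := by
  refine ⟨aestronglyMeasurable_divNorm hh.continuous.aestronglyMeasurable,
    (hh.eLpNorm_divNorm_le hs).trans_lt (ENNReal.mul_lt_top ?_ (hh.memLp_complexGradient hs).2)⟩
  simp only [ENNReal.inv_lt_top, ENNReal.ofReal_pos]
  positivity

/-- Trades the Euler term, a classical derivative, for the Hardy deficit, which makes sense for weak
gradients and passes to the limit. -/
theorem ContDiff.eLpNorm_divNorm_eulerOperator_le (hh : ContDiff ℝ 1 h)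
    (hs : HasCompactSupport h) :
    eLpNorm (divNorm (eulerOperator h)) 2 volume ^ 2 ≤ ENNReal.ofReal
      (l2NormSq (complexGradient h) - ((m + 1) / 2 : ℝ) ^ 2 * l2NormSq (divNorm h)) := by
  have h1 := eLpNorm_hardy_with_remainder hh hs
  rw [← ofReal_l2NormSq (hh.memLp_divNorm hs), ← ofReal_l2NormSq (hh.memLp_complexGradient hs),
    ← ENNReal.ofReal_mul (by positivity)] at h1
  rw [ENNReal.ofReal_sub _ (mul_nonneg (by positivity) (l2NormSq_nonneg _))]
  exact ENNReal.le_sub_of_add_le_right ENNReal.ofReal_ne_top h1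

theorem ContDiff.hardy_deficit_nonneg (hh : ContDiff ℝ 1 h) (hs : HasCompactSupport h) :
    0 ≤ l2NormSq (complexGradient h) - ((m + 1) / 2 : ℝ) ^ 2 * l2NormSq (divNorm h) := by
  have h1 := le_add_self.trans (eLpNorm_hardy_with_remainder hh hs)
  rw [← ofReal_l2NormSq (hh.memLp_divNorm hs), ← ofReal_l2NormSq (hh.memLp_complexGradient hs),
    ← ENNReal.ofReal_mul (by positivity), ENNReal.ofReal_le_ofReal_iff (l2NormSq_nonneg _)] at h1
  exact sub_nonneg.2 h1


namespace ApproximatesInSobolev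

theorem tendsto_hardy_deficit (hH : ApproximatesInSobolev H h g)
    (hh : AEStronglyMeasurable h volume) (hg : MemLp g 2 volume) :
    Tendsto (fun k => l2NormSq (complexGradient (H k)) -
      ((m + 1) / 2 : ℝ) ^ 2 * l2NormSq (divNorm (H k))) atTop
      (𝓝 (l2NormSq g - ((m + 1) / 2 : ℝ) ^ 2 * l2NormSq (divNorm h))) :=
  (tendsto_l2NormSq (fun k => (continuous_complexGradient (hH.contDiff k)).aestronglyMeasurable) hg
    hH.tendsto_gradient).sub ((tendsto_l2NormSq (fun k =>
      ((hH.contDiff k).memLp_divNorm (hH.hasCompactSupport k)).1) (hH.memLp_divNorm hh hg)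
      (hH.tendsto_divNorm hh hg)).const_mul _)

theorem hardy_deficit_nonneg (hH : ApproximatesInSobolev H h g)
    (hh : AEStronglyMeasurable h volume) (hg : MemLp g 2 volume) :
    0 ≤ l2NormSq g - ((m + 1) / 2 : ℝ) ^ 2 * l2NormSq (divNorm h) :=
  ge_of_tendsto' (hH.tendsto_hardy_deficit hh hg) fun k =>
    (hH.contDiff k).hardy_deficit_nonneg (hH.hasCompactSupport k)

theorem eLpNorm_sphericalMean_sq_le (hH : ApproximatesInSobolev H h g)
    (hh : MemLp h 2 volume) (hg : MemLp g 2 volume) :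
    eLpNorm (fun r : Set.Ioi (0 : ℝ) => sphericalMean h (r : ℝ)) (sobolevExponent (m + 3))
      (radialMeasure (m + 3)) ^ 2 ≤ interpolationConst m *
      (ENNReal.ofReal (l2NormSq g - ((m + 1) / 2 : ℝ) ^ 2 * l2NormSq (divNorm h)) ^
          (1 / ((m : ℝ) + 3)) *
        ENNReal.ofReal (l2NormSq (divNorm h)) ^ (1 - 1 / ((m : ℝ) + 3))) := by
  have hexp : 0 ≤ 1 - 1 / ((m : ℝ) + 3) := by
    rw [sub_nonneg, div_le_one (by positivity)]
    linarith [Nat.cast_nonneg (α := ℝ) m]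
  set Q : ℕ → ℝ := fun k => l2NormSq (complexGradient (H k)) -
      ((m + 1) / 2 : ℝ) ^ 2 * l2NormSq (divNorm (H k))
  set B : ℕ → ℝ := fun k => l2NormSq (divNorm (H k))
  have hm : ∀ k, MemLp (H k) 2 volume := fun k =>
    (hH.contDiff k).continuous.memLp_of_hasCompactSupport (hH.hasCompactSupport k)
  have hQ : Tendsto Q atTop (𝓝 _) := hH.tendsto_hardy_deficit hh.1 hg
  have hB : Tendsto B atTop (𝓝 _) := tendsto_l2NormSq (fun k =>
      ((hH.contDiff k).memLp_divNorm (hH.hasCompactSupport k)).1) (hH.memLp_divNorm hh.1 hg)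
      (hH.tendsto_divNorm hh.1 hg)
  have hfin : ∀ {a b : ℝ}, 0 ≤ b → ENNReal.ofReal a ^ b ≠ ⊤ := fun hb =>
    ENNReal.rpow_ne_top_of_nonneg hb ENNReal.ofReal_ne_top
  have hR := (ENNReal.Tendsto.const_mul (a := interpolationConst m) (ENNReal.Tendsto.mul
    ((ENNReal.tendsto_ofReal hQ).ennrpow_const (1 / ((m : ℝ) + 3))) (Or.inr (hfin hexp))
    ((ENNReal.tendsto_ofReal hB).ennrpow_const (1 - 1 / ((m : ℝ) + 3)))
      (Or.inr (hfin (by positivity)))) (Or.inr (interpolationConst_ne_top m))).ennrpow_const 2⁻¹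
  have hk : ∀ k, eLpNorm (fun r : Set.Ioi (0 : ℝ) => sphericalMean (H k) (r : ℝ))
      (sobolevExponent (m + 3)) (radialMeasure (m + 3)) ≤
      (interpolationConst m * (ENNReal.ofReal (Q k) ^ (1 / ((m : ℝ) + 3)) *
        ENNReal.ofReal (B k) ^ (1 - 1 / ((m : ℝ) + 3)))) ^ (2⁻¹ : ℝ) := by
    intro k
    have h1 := _root_.eLpNorm_sphericalMean_sq_le (hH.contDiff k) (hH.hasCompactSupport k)
    rw [ENNReal.le_rpow_inv_iff two_pos, ENNReal.rpow_two]
    refine h1.trans ?_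
    rw [ofReal_l2NormSq ((hH.contDiff k).memLp_divNorm (hH.hasCompactSupport k)),
      interpolationConst]
    gcongr
    exact (hH.contDiff k).eLpNorm_divNorm_eulerOperator_le (hH.hasCompactSupport k)
  obtain ⟨ns, hns, hae⟩ := exists_subseq_tendsto_ae_of_eLpNorm
    (fun k => aestronglyMeasurable_sphericalMean (n := m + 3) (by lia) (hm k).1)
    (aestronglyMeasurable_sphericalMean (by lia) hh.1)
    (tendsto_eLpNorm_sphericalMean (by lia) hm hh hH.tendsto)
  -- Fatou's lemma at the exponent `2*` needs only almost everywhere convergence, which the `L²`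
  -- bound on means provides.
  have hle := ((Lp.eLpNorm_lim_le_liminf_eLpNorm (p := sobolevExponent (m + 3))
    (fun k => aestronglyMeasurable_sphericalMean (by lia) (hm (ns k)).1) _ hae).trans
    (liminf_le_liminf (Eventually.of_forall fun k => hk (ns k)))).trans_eq
    (hR.comp hns.tendsto_atTop).liminf_eq
  rwa [ENNReal.le_rpow_inv_iff two_pos, ENNReal.rpow_two] at hle

end ApproximatesInSobolev

/-- The factor `ε ^ (1 - θ)` is absorbed into `B ^ (1 - θ)`; weighted AM-GM then applies to `Q` and
`ε * B`, with both weights at most `1`. -/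
theorem rpow_mul_le_of_interpolation {S C Q B θ ε : ℝ} (hC : 0 ≤ C) (hQ : 0 ≤ Q) (hB : 0 ≤ B)
    (hθ : 0 ≤ θ) (hθ1 : θ ≤ 1) (hε : 0 < ε) (hS : S ≤ C * Q ^ θ * B ^ (1 - θ)) :
    ε ^ (1 - θ) * S ≤ C * (Q + ε * B) := by
  have h1 : Q ^ θ * (ε * B) ^ (1 - θ) ≤ θ * Q + (1 - θ) * (ε * B) :=
    Real.geom_mean_le_arith_mean2_weighted hθ (by linarith) hQ (by positivity) (by ring)
  have h2 : θ * Q + (1 - θ) * (ε * B) ≤ Q + ε * B := by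
    have : 0 ≤ ε * B := by positivity
    nlinarith
  calc ε ^ (1 - θ) * S ≤ ε ^ (1 - θ) * (C * Q ^ θ * B ^ (1 - θ)) := by gcongr
    _ = C * (Q ^ θ * (ε * B) ^ (1 - θ)) := by rw [Real.mul_rpow hε.le hB]; ring
    _ ≤ C * (Q + ε * B) := by gcongr; exact h1.trans h2

end Main
theorem corollary5 (n : ℕ) (hn : 3 ≤ n) :
    ∃ C : ℝ, 0 < C ∧
      ∀ (h : EuclideanSpace ℝ (Fin n) → ℂ)
        (g : EuclideanSpace ℝ (Fin n) → EuclideanSpace ℂ (Fin n)),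
        MemLp h 2 volume → MemLp g 2 volume → IsWeakGradient h g →
        -- `h / |·|` lies in `L²`, and the quantity in braces is nonnegative
        MemLp (divNorm h) 2 volume ∧
        0 ≤ l2NormSq g - (((n : ℝ) - 2) / 2) ^ 2 * l2NormSq (divNorm h) ∧
        -- the spherical mean is a convergent integral for almost every `r`, and lies in `L^{2*}`
        (∀ᵐ r : Set.Ioi (0 : ℝ) ∂(radialMeasure n),
          Integrable (fun u : Metric.sphere (0 : EuclideanSpace ℝ (Fin n)) 1 =>
              h ((r : ℝ) • (u : EuclideanSpace ℝ (Fin n))))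
            (volume : Measure (EuclideanSpace ℝ (Fin n))).toSphere) ∧
        MemLp (fun r : Set.Ioi (0 : ℝ) => sphericalMean h (r : ℝ))
          (sobolevExponent n) (radialMeasure n) ∧
        -- the two inequalities
        sphericalMeanNormSq h ≤
          C * (l2NormSq g - (((n : ℝ) - 2) / 2) ^ 2 * l2NormSq (divNorm h)) ^ (1 / (n : ℝ)) *
            (l2NormSq (divNorm h)) ^ (1 - 1 / (n : ℝ)) ∧
        ∀ ε : ℝ, 0 < ε →
          ε ^ (1 - 1 / (n : ℝ)) * sphericalMeanNormSq h ≤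
            C * (l2NormSq g - ((((n : ℝ) - 2) / 2) ^ 2 - ε) * l2NormSq (divNorm h)) := by
  obtain ⟨m, rfl⟩ : ∃ m, n = m + 3 := ⟨n - 3, by lia⟩
  have e1 : (((m + 3 : ℕ) : ℝ) - 2) / 2 = (m + 1) / 2 := by push_cast; ring
  have e2 : ((m + 3 : ℕ) : ℝ) = m + 3 := by push_cast; ring
  have hC := ENNReal.toReal_pos (interpolationConst_ne_zero m) (interpolationConst_ne_top m)
  refine ⟨(interpolationConst m).toReal, hC, fun h g hh hg hw => ?_⟩
  obtain ⟨H, hH⟩ := hw.exists_approximatesInSobolev hh hg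
  rw [e1, e2]
  have hexp : 1 / ((m : ℝ) + 3) ≤ 1 := by
    rw [div_le_one (by positivity)]
    linarith [Nat.cast_nonneg (α := ℝ) m]
  have hQ := hH.hardy_deficit_nonneg hh.1 hg
  have hB := l2NormSq_nonneg (divNorm h)
  have hM := hH.eLpNorm_sphericalMean_sq_le hh hg
  rw [ENNReal.ofReal_rpow_of_nonneg hQ (by positivity),
    ENNReal.ofReal_rpow_of_nonneg hB (by linarith), ← ENNReal.ofReal_mul (by positivity)] at hM
  have hS : sphericalMeanNormSq h ≤ (interpolationConst m).toReal *
      (l2NormSq g - ((m + 1) / 2 : ℝ) ^ 2 * l2NormSq (divNorm h)) ^ (1 / ((m : ℝ) + 3)) *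
        (l2NormSq (divNorm h)) ^ (1 - 1 / ((m : ℝ) + 3)) := by
    have := ENNReal.toReal_mono
      (ENNReal.mul_ne_top (interpolationConst_ne_top m) ENNReal.ofReal_ne_top) hM
    rw [ENNReal.toReal_pow, ENNReal.toReal_mul, ENNReal.toReal_ofReal (by positivity),
      ← mul_assoc] at this
    exact this
  refine ⟨hH.memLp_divNorm hh.1 hg, hQ, ?_, ⟨aestronglyMeasurable_sphericalMean (by lia) hh.1, ?_⟩,
    hS, fun ε hε => ?_⟩
  · filter_upwards [ae_memLp_sphere (by lia) hh] with r hr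
    exact hr.integrable one_le_two
  · have := hM.trans_lt (ENNReal.mul_lt_top (interpolationConst_ne_top m).lt_top
      ENNReal.ofReal_lt_top)
    exact (ENNReal.pow_lt_top_iff.1 this).resolve_right two_ne_zero
  · refine (rpow_mul_le_of_interpolation hC.le hQ hB (by positivity) hexp hε hS).trans_eq ?_
    ring
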